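/- Fix a functional signature $\sigma$ (a set of symbols with finite arities, disjoint from $\{-,\rhd\}$). **Algebras.** A *difference–restriction algebra* is a nonempty $\{-,\rhd\}$-algebra isomorphic to an algebra of partial functions from a set $X$ to a set $Y$, where $f-g=f\setminus g$ and $f\rhd g=\{(x,y)\in g\mid x\in\mathrm{dom}(f)\}$. It is ordered by $a\le b\iff a-(a-b)=a$, with least element $0$; elements $a,b$ are *compatible* if $a\rhd b=b\rhd a$. The algebra is *finitarily compatibly complete* if every finite set of pairwise compatible elements has a join. An $n$-ary operation $\Omega$ is *compatibility preserving* if $\Omega(a_1,\dots,a_n)$ and $\Omega(a_1',\dots,a_n')$ are compatible whenever $a_i,a_i'$ are compatible for all $i$; it is an *operator* if it equals $0$ as soon as one argument is $0$, and preserves, in each argument, every existing binary join. $\mathrm{DRA}(\sigma)$ is the category of difference–restriction algebras equipped with a compatibility preserving operator of the corresponding arity for each symbol of $\sigma$, with all homomorphisms of $(\{-,\rhd\}\cup\sigma)$-algebras. **Spaces.** A *Hausdorff étale space* is a surjective local homeomorphism $\pi\colon X\to X_0$ with $X$ and $X_0$ Hausdorff. A morphism from $\pi\colon X\to X_0$ to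 $\rho\colon Y\to Y_0$ is a partial function $\varphi\colon X\rightharpoonup Y$ such that preimages of open sets are open, preimages of compact sets are compact, and: (i) if $\varphi(x),\varphi(x')$ are defined and $\pi(x)=\pi(x')$, then $\rho(\varphi(x))=\rho(\varphi(x'))$; (ii) $\varphi$ is injective on each fibre of $\pi$; (iii) if $\varphi(x)$ is defined and $\rho(y)=\rho(\varphi(x))$, then $y=\varphi(x')$ for some $x'$ with $\pi(x')=\pi(x)$. For an $(n+1)$-ary relation $R$ on $X$ put $\Omega_R(S_1,\dots,S_n)=\{x_{n+1}\mid\exists x_i\in S_i\ (1\le i\le n)\colon R x_1\dots x_{n+1}\}$. $R$ is *spectral* if $\Omega_R$ sends open sets to open sets and compact open sets to compact open sets; it is *tight* if $Rx_1\dots x_{n+1}$ holds whenever $x_{n+1}\in\Omega_R(S_1,\dots,S_n)$ for all compact open $S_1\ni x_1,\dots,S_n\ni x_n$. Writing $xCy$ for "$\pi(x)=\pi(y)$ implies $x=y$", $R$ has the *compatibility property* if $x_iCx_i'$ ($1\le i\le n$), $Rx_1\dots x_{n+1}$ and $Rx_1'\dots x_{n+1}'$ imply $x_{n+1}Cx_{n+1}'$.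 $\mathrm{HausEt}(\sigma)$ is the category whose objects are Hausdorff étale spaces equipped, for each $n$-ary symbol $\Omega$ of $\sigma$, with an $(n+1)$-ary tight spectral relation $R_\Omega$ that has the compatibility property, and whose morphisms are the morphisms $\varphi$ as above such that, for each symbol: if $Rx_1\dots x_{n+1}$ and $\varphi(x_1),\dots,\varphi(x_n)$ are defined, then $\varphi(x_{n+1})$ is defined and $R\varphi(x_1)\dots\varphi(x_{n+1})$; and if $\varphi(x_{n+1})$ is defined and $Ry_1\dots y_n\varphi(x_{n+1})$, then there are $x_1,\dots,x_n\in\mathrm{dom}(\varphi)$ with $\varphi(x_i)=y_i$ and $Rx_1\dots x_{n+1}$. **Corollary.** Let $\mathrm{C_{fin}DRA}(\sigma)$ be the full subcategory of $\mathrm{DRA}(\sigma)$ of the finitarily compatibly complete algebras, and $\mathrm{Stone^{+}Et}(\sigma)$ the full subcategory of $\mathrm{HausEt}(\sigma)$ of the objects whose total space $X$ is locally compact and zero-dimensional (every point has a neighbourhood basis of compact sets and one of clopen sets); write $\mathrm{C_{fin}DRA}$ and $\mathrm{Stone^{+}Et}$ for the corresponding categories without operators and relations. There are equivalences $$\mathrm{C_{fin}DRA}\simeq(\mathrm{Stone^{+}Et})^{\mathrm{op}},\qquad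 \mathrm{C_{fin}DRA}(\sigma)\simeq\mathrm{Stone^{+}Et}(\sigma)^{\mathrm{op}},$$ given, up to natural isomorphism, as follows, and commuting up to natural isomorphism, in both directions, with the functors that forget the operators and the relations. * An algebra $A$ is sent to the quotient map from the space of its maximal (proper) filters, with the topology generated by the sets $\{\mu\mid a\in\mu\}$, onto the quotient by the equivalence $\mu\approx\nu\iff(a\rhd b\in\nu$ and $b\rhd a\in\mu$ for all $a\in\mu$, $b\in\nu)$; for each symbol $\Omega$, $R_\Omega\mu_1\dots\mu_{n+1}$ holds if and only if $\Omega(a_1,\dots,a_n)\in\mu_{n+1}$ for all $a_i\in\mu_i$; a homomorphism $h$ is sent to the partial function $\xi\mapsto h^{-1}(\xi)$. * A space $\pi\colon X\to X_0$ is sent to the algebra of the compact open $U\subseteq X$ on which $\pi$ is injective, with $U-V=U\setminus V$, $U\rhd V=\pi^{-1}(\pi(U))\cap V$ and operations $\Omega_{R_\Omega}$; a morphism $\varphi$ is sent to $U\mapsto\varphi^{-1}(U)$. -/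

import Mathlib

open CategoryTheory Opposite Topology

universe u v

/-! ### Partial functions as functional relations -/

/-- A set of pairs that is (the graph of) a partial function from `X` to `Y`. -/
def IsPartialFunction {X Y : Type u} (f : Set (X × Y)) : Prop :=
  ∀ x y z, (x, y) ∈ f → (x, z) ∈ f → y = z

/-- The domain of a set of pairs. -/
def pairsDom {X Y : Type u} (f : Set (X × Y)) : Set X := {x | ∃ y, (x, y) ∈ f}

/-- Domain restriction: the second argument restricted to the domain of the first. -/
def domRestrict {X Y : Type u} (f g : Set (X × Y)) : Set (X × Y) :=
  {p | p.1 ∈ pairsDom f ∧ p ∈ g}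

/-! ### Difference--restriction algebras -/

/-- A difference--restriction algebra: a (nonempty) algebra with two binary operations that is
isomorphic to an algebra of partial functions (from some set `X` to some set `Y`) under relative
complement and domain restriction. The isomorphism is given as an embedding into the set of all
partial functions; its image is automatically closed under the operations. -/
structure DRA where
  carrier : Type u
  diff : carrier → carrier → carrier
  rest : carrier → carrier → carrier
  nonempty : Nonempty carrier
  representable : ∃ (X Y : Type u) (r : carrier → Set (X × Y)),
    Function.Injective r ∧ (∀ a, IsPartialFunction (r a)) ∧
    (∀ a b, r (diff a b) = r a \ r b) ∧
    (∀ a b, r (rest a b) = domRestrict (r a) (r b))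

namespace DRA

instance : CoeSort DRA.{u} (Type u) := ⟨DRA.carrier⟩

variable (A : DRA.{u})

/-- The derived meet operation. -/
def meet (a b : A) : A := A.diff a (A.diff a b)

/-- Two elements are compatible when each restricts to the domain of the other in the same way. -/
def Compat (a b : A) : Prop := A.rest a b = A.rest b a

/-- The semilattice order: `a ≤ b` if and only if `meet a b = a`. -/
instance : PartialOrder A.carrier where
  le a b := A.meet a b = a
  le_refl a := by
    obtain ⟨X, Y, r, hi, -, hd, -⟩ := A.representable
    apply hi
    simp [meet, hd]
  le_trans a b c h₁ h₂ := by
    obtain ⟨X, Y, r, hi, -, hd, -⟩ := A.representable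
    have h₁ : A.meet a b = a := h₁
    have h₂ : A.meet b c = b := h₂
    have k₁ := congrArg r h₁
    have k₂ := congrArg r h₂
    change A.meet a c = a
    apply hi
    simp only [meet, hd, sdiff_sdiff_right_self, Set.inf_eq_inter, Set.inter_eq_left] at k₁ k₂ ⊢
    exact k₁.trans k₂
  le_antisymm a b h₁ h₂ := by
    obtain ⟨X, Y, r, hi, -, hd, -⟩ := A.representable
    have h₁ : A.meet a b = a := h₁
    have h₂ : A.meet b a = b := h₂
    have k₁ := congrArg r h₁
    have k₂ := congrArg r h₂
    apply hi
    simp only [meet, hd, sdiff_sdiff_right_self, Set.inf_eq_inter, Set.inter_eq_left] at k₁ k₂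
    exact k₁.antisymm k₂

/-- Every finite set of pairwise compatible elements has a join. -/
def FinitarilyCompatiblyComplete : Prop :=
  ∀ S : Set A, S.Finite → S.Pairwise A.Compat → ∃ j, IsLUB S j

variable {A}

/-- Homomorphisms of algebras with a difference and a restriction operation. -/
@[ext]
structure Hom (A B : DRA.{u}) where
  toFun : A → B
  map_diff : ∀ a b, toFun (A.diff a b) = B.diff (toFun a) (toFun b)
  map_rest : ∀ a b, toFun (A.rest a b) = B.rest (toFun a) (toFun b)

instance : Category DRA.{u} where
  Hom := Hom
  id A := ⟨fun a => a, fun _ _ => rfl, fun _ _ => rfl⟩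
  comp f g := ⟨fun a => g.toFun (f.toFun a),
    fun a b => by rw [f.map_diff, g.map_diff], fun a b => by rw [f.map_rest, g.map_rest]⟩

end DRA

/-! ### Hausdorff étale spaces -/

/-- A Hausdorff étale space: a surjective local homeomorphism between Hausdorff spaces. -/
structure HausEt where
  X : Type u
  X₀ : Type u
  [topX : TopologicalSpace X]
  [topX₀ : TopologicalSpace X₀]
  proj : X → X₀
  surjective : Function.Surjective proj
  localHomeo : IsLocalHomeomorph proj
  t2 : T2Space X
  t2_base : T2Space X₀

namespace HausEt

attribute [instance] HausEt.topX HausEt.topX₀ HausEt.t2 HausEt.t2_base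

/-- Morphisms of Hausdorff étale spaces: continuous, proper partial functions that preserve
equivalence, are fibrewise injective and fibrewise surjective. -/
@[ext]
structure Hom (P Q : HausEt.{u}) where
  toPFun : P.X →. Q.X
  continuous : PContinuous toPFun
  proper : ∀ V : Set Q.X, IsCompact V → IsCompact (toPFun.preimage V)
  preserves : ∀ x x' y y', y ∈ toPFun x → y' ∈ toPFun x' →
    P.proj x = P.proj x' → Q.proj y = Q.proj y'
  fibre_injective : ∀ x x' y, y ∈ toPFun x → y ∈ toPFun x' → P.proj x = P.proj x' → x = x'
  fibre_surjective : ∀ x y y', y ∈ toPFun x → Q.proj y' = Q.proj y →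
    ∃ x', P.proj x' = P.proj x ∧ y' ∈ toPFun x'

/-- The identity morphism. -/
def Hom.id (P : HausEt.{u}) : Hom P P where
  toPFun := PFun.id P.X
  continuous := by
    intro s hs
    have : (PFun.id P.X).preimage s = s := by ext; simp [PFun.mem_preimage]
    rwa [this]
  proper := by
    intro s hs
    have : (PFun.id P.X).preimage s = s := by ext; simp [PFun.mem_preimage]
    rwa [this]
  preserves := by
    intro x x' y y' h h' e
    simp only [PFun.id_apply, Part.mem_some_iff] at h h'
    rw [h, h', e]
  fibre_injective := by
    intro x x' y h h' _
    simp only [PFun.id_apply, Part.mem_some_iff] at h h'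
    rw [← h, ← h']
  fibre_surjective := by
    intro x y y' h e
    simp only [PFun.id_apply, Part.mem_some_iff] at h
    exact ⟨y', by rw [e, h], by simp⟩

/-- Composition of morphisms: composition of partial functions. -/
def Hom.comp {P Q S : HausEt.{u}} (f : Hom P Q) (g : Hom Q S) : Hom P S where
  toPFun := g.toPFun.comp f.toPFun
  continuous := by
    intro s hs
    rw [PFun.preimage_comp]
    exact f.continuous _ (g.continuous _ hs)
  proper := by
    intro s hs
    rw [PFun.preimage_comp]
    exact f.proper _ (g.proper _ hs)
  preserves := by
    intro x x' z z' h h' e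
    obtain ⟨y, hy, hz⟩ := Part.mem_bind_iff.1 h
    obtain ⟨y', hy', hz'⟩ := Part.mem_bind_iff.1 h'
    exact g.preserves _ _ _ _ hz hz' (f.preserves _ _ _ _ hy hy' e)
  fibre_injective := by
    intro x x' z h h' e
    obtain ⟨y, hy, hz⟩ := Part.mem_bind_iff.1 h
    obtain ⟨y', hy', hz'⟩ := Part.mem_bind_iff.1 h'
    have hyy := g.fibre_injective _ _ _ hz hz' (f.preserves _ _ _ _ hy hy' e)
    subst hyy
    exact f.fibre_injective _ _ _ hy hy' e
  fibre_surjective := by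
    intro x z z' h e
    obtain ⟨y, hy, hz⟩ := Part.mem_bind_iff.1 h
    obtain ⟨y', hy', hz'⟩ := g.fibre_surjective _ _ _ hz e
    obtain ⟨x', hx', hxy'⟩ := f.fibre_surjective _ _ _ hy hy'
    exact ⟨x', hx', Part.mem_bind_iff.2 ⟨y', hxy', hz'⟩⟩

instance : Category HausEt.{u} where
  Hom := Hom
  id := Hom.id
  comp := Hom.comp
  id_comp f := Hom.ext (PFun.comp_id f.toPFun)
  comp_id f := Hom.ext (PFun.id_comp f.toPFun)
  assoc f g h := Hom.ext (PFun.comp_assoc h.toPFun g.toPFun f.toPFun).symm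

end HausEt

/-- Every point has a neighbourhood basis of clopen sets. -/
def IsZeroDimensional (X : Type u) [TopologicalSpace X] : Prop :=
  ∀ x : X, ∀ U ∈ 𝓝 x, ∃ V ∈ 𝓝 x, V ⊆ U ∧ IsClopen V

/-! ### The two categories without operators -/

/-- The finitarily compatibly complete difference--restriction algebras. -/
def fcc : ObjectProperty DRA.{u} := fun A => A.FinitarilyCompatiblyComplete

/-- The étale spaces whose total space is locally compact and zero-dimensional. -/
def lczd : ObjectProperty HausEt.{u} := fun P => LocallyCompactSpace P.X ∧ IsZeroDimensional P.X

abbrev CfinDRA := (fcc.{u}).FullSubcategory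

abbrev StoneEt := (lczd.{u}).FullSubcategory

/-! ### Compatibility preserving operators -/

/-- A functional signature: symbols with (finite) arities. -/
structure OpSignature where
  Symb : Type v
  arity : Symb → ℕ

namespace DRA

variable (A : DRA.{u}) {n : ℕ} (f : (Fin n → A) → A)

def CompatPreserving : Prop :=
  ∀ a a' : Fin n → A, (∀ i, A.Compat (a i) (a' i)) → A.Compat (f a) (f a')

/-- The value is the least element as soon as one argument is. -/
def Normal : Prop := ∀ (a : Fin n → A) (i : Fin n), IsBot (a i) → IsBot (f a)

/-- Existing binary joins are preserved in each argument. -/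
def Additive : Prop :=
  ∀ (a : Fin n → A) (i : Fin n) (b c d : A), IsLUB {b, c} d →
    IsLUB {f (Function.update a i b), f (Function.update a i c)} (f (Function.update a i d))

def IsOperator : Prop := A.Normal f ∧ A.Additive f

end DRA

/-- Difference--restriction algebras with compatibility preserving operators indexed by `σ`. -/
structure DRAOp (σ : OpSignature.{v}) where
  alg : DRA.{u}
  op : ∀ s : σ.Symb, (Fin (σ.arity s) → alg) → alg
  compat : ∀ s, alg.CompatPreserving (op s)
  operator : ∀ s, alg.IsOperator (op s)

namespace DRAOp

variable {σ : OpSignature.{v}}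

/-- Homomorphisms of the full signature. -/
@[ext]
structure Hom (A B : DRAOp.{u} σ) where
  base : A.alg ⟶ B.alg
  map_op : ∀ s a, base.toFun (A.op s a) = B.op s (fun i => base.toFun (a i))

instance : Category (DRAOp.{u} σ) where
  Hom := Hom
  id A := ⟨𝟙 A.alg, fun _ _ => rfl⟩
  comp f g := ⟨f.base ≫ g.base, fun s a => by
    change g.base.toFun (f.base.toFun _) = _
    rw [f.map_op, g.map_op]; rfl⟩

/-- The reduct functor forgetting the operators. -/
def forget (σ : OpSignature.{v}) : DRAOp.{u} σ ⥤ DRA.{u} where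
  obj A := A.alg
  map f := f.base

end DRAOp

/-! ### Relations on étale spaces

An `(n+1)`-ary relation on `X` is a predicate `R : (Fin n → X) → X → Prop`; the second argument
is the last coordinate. -/

section Relations

variable {X : Type u} {n : ℕ} (R : (Fin n → X) → X → Prop)

/-- The operation on subsets induced by a relation. -/
def relImage (S : Fin n → Set X) : Set X := {y | ∃ x : Fin n → X, (∀ i, x i ∈ S i) ∧ R x y}

variable [TopologicalSpace X]

def IsContinuousRel : Prop := ∀ S : Fin n → Set X, (∀ i, IsOpen (S i)) → IsOpen (relImage R S)

def IsSpectralRel : Prop :=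
  IsContinuousRel R ∧ ∀ S : Fin n → Set X, (∀ i, IsCompact (S i) ∧ IsOpen (S i)) →
    IsCompact (relImage R S) ∧ IsOpen (relImage R S)

def IsTightRel : Prop :=
  ∀ (x : Fin n → X) (y : X),
    (∀ S : Fin n → Set X, (∀ i, IsCompact (S i) ∧ IsOpen (S i)) → (∀ i, x i ∈ S i) →
      y ∈ relImage R S) → R x y

end Relations

namespace HausEt

variable (P : HausEt.{u})

/-- Compatibility of points: equal as soon as they lie in the same fibre. -/
def PtCompat (x y : P.X) : Prop := P.proj x = P.proj y → x = y

/-- The compatibility property of a relation. -/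
def CompatProperty {n : ℕ} (R : (Fin n → P.X) → P.X → Prop) : Prop :=
  ∀ (x x' : Fin n → P.X) (y y' : P.X), (∀ i, P.PtCompat (x i) (x' i)) →
    R x y → R x' y' → P.PtCompat y y'

end HausEt

/-- The condition that relations are carried forward along a partial function. -/
def ReverseForth {X Y : Type u} {n : ℕ} (φ : X →. Y) (R : (Fin n → X) → X → Prop)
    (S : (Fin n → Y) → Y → Prop) : Prop :=
  ∀ (x : Fin n → X) (x' : X) (y : Fin n → Y), R x x' → (∀ i, y i ∈ φ (x i)) →
    ∃ y', y' ∈ φ x' ∧ S y y'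

/-- The condition that relations are lifted back along a partial function. -/
def BackCond {X Y : Type u} {n : ℕ} (φ : X →. Y) (R : (Fin n → X) → X → Prop)
    (S : (Fin n → Y) → Y → Prop) : Prop :=
  ∀ (x' : X) (y : Fin n → Y) (y' : Y), y' ∈ φ x' → S y y' →
    ∃ x : Fin n → X, (∀ i, y i ∈ φ (x i)) ∧ R x x'

/-- Hausdorff étale spaces with relations indexed by `σ`. -/
structure HausEtOp (σ : OpSignature.{v}) where
  space : HausEt.{u}
  rel : ∀ s : σ.Symb, (Fin (σ.arity s) → space.X) → space.X → Prop
  tight : ∀ s, IsTightRel (rel s)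
  spectral : ∀ s, IsSpectralRel (rel s)
  compat : ∀ s, space.CompatProperty (rel s)

namespace HausEtOp

variable {σ : OpSignature.{v}}

@[ext]
structure Hom (P Q : HausEtOp.{u} σ) where
  base : P.space ⟶ Q.space
  forth : ∀ s, ReverseForth base.toPFun (P.rel s) (Q.rel s)
  back : ∀ s, BackCond base.toPFun (P.rel s) (Q.rel s)

instance : Category (HausEtOp.{u} σ) where
  Hom := Hom
  id P :=
    { base := 𝟙 P.space
      forth := by
        intro s x x' y h hy
        have : y = x := by
          funext i
          exact (Part.mem_some_iff).1 (hy i)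
        exact ⟨x', Part.mem_some x', this ▸ h⟩
      back := by
        intro s x' y y' hy h
        have : y' = x' := (Part.mem_some_iff).1 hy
        exact ⟨y, fun i => Part.mem_some (y i), this ▸ h⟩ }
  comp {P Q S} f g :=
    { base := f.base ≫ g.base
      forth := by
        intro s x x' z h hz
        have hz' : ∀ i, ∃ y, y ∈ f.base.toPFun (x i) ∧ z i ∈ g.base.toPFun y :=
          fun i => Part.mem_bind_iff.1 (hz i)
        choose y hy hyz using hz'
        obtain ⟨y', hy', hS⟩ := f.forth s x x' y h hy
        obtain ⟨z', hz', hT⟩ := g.forth s y y' z hS hyz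
        exact ⟨z', Part.mem_bind_iff.2 ⟨y', hy', hz'⟩, hT⟩
      back := by
        intro s x' z z' hz h
        obtain ⟨y', hy', hyz⟩ : ∃ y, y ∈ f.base.toPFun x' ∧ z' ∈ g.base.toPFun y :=
          Part.mem_bind_iff.1 hz
        obtain ⟨y, hy, hR⟩ := g.back s y' z z' hyz h
        obtain ⟨x, hx, hR'⟩ := f.back s x' y y' hy' hR
        exact ⟨x, fun i => Part.mem_bind_iff.2 ⟨y i, hx i, hy i⟩, hR'⟩ }
  id_comp f := Hom.ext (Category.id_comp f.base)
  comp_id f := Hom.ext (Category.comp_id f.base)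
  assoc f g h := Hom.ext (Category.assoc f.base g.base h.base)

/-- The functor forgetting the relations. -/
def forget (σ : OpSignature.{v}) : HausEtOp.{u} σ ⥤ HausEt.{u} where
  obj P := P.space
  map f := f.base

end HausEtOp

/-! ### The two categories with operators -/

def fccOp (σ : OpSignature.{v}) : ObjectProperty (DRAOp.{u} σ) := fun A => fcc A.alg

def lczdOp (σ : OpSignature.{v}) : ObjectProperty (HausEtOp.{u} σ) := fun P => lczd P.space

abbrev CfinDRAOp (σ : OpSignature.{v}) := (fccOp.{u} σ).FullSubcategory

abbrev StoneEtOp (σ : OpSignature.{v}) := (lczdOp.{u} σ).FullSubcategory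

/-- The reduct functor on finitarily compatibly complete algebras. -/
def CfinDRAOp.forget (σ : OpSignature.{v}) : CfinDRAOp.{u} σ ⥤ CfinDRA.{u} :=
  fcc.lift ((fccOp σ).ι ⋙ DRAOp.forget σ) (fun A => A.property)

/-- The reduct functor on locally compact zero-dimensional Hausdorff étale spaces. -/
def StoneEtOp.forget (σ : OpSignature.{v}) : StoneEtOp.{u} σ ⥤ StoneEt.{u} :=
  lczd.lift ((lczdOp σ).ι ⋙ HausEtOp.forget σ) (fun P => P.property)

/-! ### The space of maximal filters -/

/-- Maximal filters: proper filters that are maximal among the proper filters. -/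
def MaxFilter (A : DRA.{u}) : Type u :=
  {F : Set A // Maximal (fun G : Set A => Order.IsPFilter G ∧ G ≠ Set.univ) F}

namespace MaxFilter

variable {A : DRA.{u}}

/-- The topology generated by the sets of maximal filters containing a given element. -/
instance : TopologicalSpace (MaxFilter A) :=
  TopologicalSpace.generateFrom (Set.range fun a : A => {μ : MaxFilter A | a ∈ μ.1})

/-- The equivalence relation induced by domain inclusion of filters. -/
def Equivalent (μ ν : MaxFilter A) : Prop :=
  (∀ a ∈ μ.1, ∀ b ∈ ν.1, A.rest a b ∈ ν.1) ∧ (∀ b ∈ ν.1, ∀ a ∈ μ.1, A.rest b a ∈ μ.1)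

/-- The relation on maximal filters induced by an operation. -/
def opRel {n : ℕ} (f : (Fin n → A) → A) (μ : Fin n → MaxFilter A) (ν : MaxFilter A) : Prop :=
  ∀ a : Fin n → A, (∀ i, a i ∈ (μ i).1) → f a ∈ ν.1

end MaxFilter

/-- An identification of the étale space `P` with the quotient of the space of maximal filters
of `A` by equivalence. (The topology of the base of an étale space is the quotient topology, so
that a homeomorphism of the total spaces matching the fibres induces one of the bases.) -/
structure SpectrumIso (A : DRA.{u}) (P : HausEt.{u}) where
  homeo : P.X ≃ₜ MaxFilter A
  fibres : ∀ x y, P.proj x = P.proj y ↔ (homeo x).Equivalent (homeo y)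

/-- Under the identifications `θ`, the functor `V` sends a homomorphism `h` to the partial function
that takes inverse images of maximal filters under `h` (whenever these are maximal filters). -/
def SpectrumNatural {C : Type*} [Category C] {U : C ⥤ DRA.{u}} {V : C ⥤ HausEt.{u}ᵒᵖ}
    (θ : ∀ A : C, SpectrumIso (U.obj A) (V.obj A).unop) : Prop :=
  ∀ (A B : C) (h : A ⟶ B) (ξ : (V.obj B).unop.X) (x : (V.obj A).unop.X),
    x ∈ (V.map h).unop.toPFun ξ ↔
      ((θ A).homeo x).1 = (U.map h).toFun ⁻¹' ((θ B).homeo ξ).1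

/-- The functor is (naturally isomorphic to) the one sending an algebra to its étale space of
maximal filters and a homomorphism to the inverse image map. -/
def IsSpectrumFunctor (F : CfinDRA.{u} ⥤ StoneEt.{u}ᵒᵖ) : Prop :=
  ∃ θ : ∀ A : CfinDRA.{u}, SpectrumIso (fcc.ι.obj A) ((F ⋙ lczd.ι.op).obj A).unop,
    SpectrumNatural θ

/-- As above, and the relations are the ones induced by the operators. -/
def IsSpectrumFunctorOp {σ : OpSignature.{v}} (F : CfinDRAOp.{u} σ ⥤ (StoneEtOp.{u} σ)ᵒᵖ) :
    Prop :=
  ∃ θ : ∀ A : CfinDRAOp.{u} σ, SpectrumIso (((fccOp σ).ι ⋙ DRAOp.forget σ).obj A)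
      ((F ⋙ ((lczdOp σ).ι ⋙ HausEtOp.forget σ).op).obj A).unop,
    SpectrumNatural θ ∧
    ∀ (A : CfinDRAOp.{u} σ) (s : σ.Symb) (x : Fin (σ.arity s) → (F.obj A).unop.obj.space.X)
      (y : (F.obj A).unop.obj.space.X),
      (F.obj A).unop.obj.rel s x y ↔
        MaxFilter.opRel (A.obj.op s) (fun i => (θ A).homeo (x i)) ((θ A).homeo y)

/-! ### The algebra of compact open sets -/

/-- The compact open subsets of the total space on which the projection is injective. -/
def CompactOpenSections (P : HausEt.{u}) : Type u :=
  {U : Set P.X // IsCompact U ∧ IsOpen U ∧ Set.InjOn P.proj U}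

/-- An identification of the algebra `A` with the compact open subsets of `P` on which
the projection is injective, with their difference and restriction operations. -/
structure SectionsIso (P : HausEt.{u}) (A : DRA.{u}) where
  equiv : A ≃ CompactOpenSections P
  map_diff : ∀ a b, (equiv (A.diff a b)).1 = (equiv a).1 \ (equiv b).1
  map_rest : ∀ a b,
    (equiv (A.rest a b)).1 = P.proj ⁻¹' (P.proj '' (equiv a).1) ∩ (equiv b).1

/-- Under the identifications `κ`, the functor `V` sends a morphism to the map that takes
inverse images under it. -/
def SectionsNatural {C : Type*} [Category C] {U : C ⥤ HausEt.{u}ᵒᵖ} {V : C ⥤ DRA.{u}}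
    (κ : ∀ P : C, SectionsIso (U.obj P).unop (V.obj P)) : Prop :=
  ∀ (P Q : C) (f : P ⟶ Q) (a : V.obj P),
    ((κ Q).equiv ((V.map f).toFun a)).1 = (U.map f).unop.toPFun.preimage ((κ P).equiv a).1

/-- The functor is (naturally isomorphic to) the one sending an étale space to the algebra of
compact open sets on which the projection is injective and a morphism to the inverse image map. -/
def IsSectionsFunctor (G : StoneEt.{u}ᵒᵖ ⥤ CfinDRA.{u}) : Prop :=
  ∃ κ : ∀ P : StoneEt.{u}ᵒᵖ, SectionsIso (lczd.ι.op.obj P).unop ((G ⋙ fcc.ι).obj P),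
    SectionsNatural κ

/-- As above, and the operators are the ones induced by the relations. -/
def IsSectionsFunctorOp {σ : OpSignature.{v}} (G : (StoneEtOp.{u} σ)ᵒᵖ ⥤ CfinDRAOp.{u} σ) :
    Prop :=
  ∃ κ : ∀ P : (StoneEtOp.{u} σ)ᵒᵖ,
      SectionsIso (((lczdOp σ).ι ⋙ HausEtOp.forget σ).op.obj P).unop
        ((G ⋙ (fccOp σ).ι ⋙ DRAOp.forget σ).obj P),
    SectionsNatural κ ∧
    ∀ (P : (StoneEtOp.{u} σ)ᵒᵖ) (s : σ.Symb) (a : Fin (σ.arity s) → (G.obj P).obj.alg),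
      ((κ P).equiv ((G.obj P).obj.op s a)).1 =
        relImage (P.unop.obj.rel s) (fun i => ((κ P).equiv (a i)).1)

/-! The result is Stone duality for generalised Boolean algebras, enriched with domain restriction.
Write `â` for the set of maximal filters through `a`. Since the elements below a given one form a
Boolean algebra, the maximal filters are the proper filters that, with `a`, contain `b` or `a - b`
for every `b`. They are prime, and `exists_maxFilter` (Zorn) separates filters from ideals, so that
the sets `â` are compact open and determine `a`. Restriction is governed by `rest_mem_iff`: `a ▹ b`
lies in `ξ` iff `b` does and the fibre of `ξ` meets `â`. The work is in `exists_equivalent`, which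
moves a filter along its fibre. Hence the quotient map is open, injective on each `â`, and has a
Hausdorff target.

The unit `a ↦ â` always embeds the algebra into the sections of its spectrum. A compact open section
is a finite union of sets `â`; injectivity of the projection makes the elements `a` involved
pairwise compatible, and completeness supplies their join (`toSections_surjective`). The counit
sends `x` to the filter of sections through `x`. Local compactness and zero-dimensionality make the
sections a basis, and compactness gives every maximal filter a point (`ptFilter_surjective`).
Morphisms are partial because an inverse image of a maximal filter may be empty; if nonempty, it is
maximal (`exists_mem_comap`).

For operators, `exists_opRel` enlarges filters to maximal ones one coordinate at a time, in the
manner of Jónsson and Tarski. It yields `relImage_opRel_basicOpen`: the relation on the spectrum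
induces the given operator on the sets `â`. Conversely, tightness recovers a relation from its
operation on sections (`opRel_ptFilter_iff`). -/

/-! ### Elementary algebra -/

namespace DRA

section Algebra

variable (A : DRA.{u})

theorem le_def (a b : A) : a ≤ b ↔ A.meet a b = a := Iff.rfl

/-- The least element. -/
noncomputable def bot : A := A.diff A.nonempty.some A.nonempty.some

/-- Identities and inequalities can be checked on a representation by partial functions. -/
theorem exists_rep : ∃ (X Y : Type u) (r : A → X → Y → Prop),
    (∀ a b, a ≤ b ↔ ∀ x y, r a x y → r b x y) ∧
    (∀ a x y z, r a x y → r a x z → y = z) ∧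
    (∀ a b x y, r (A.diff a b) x y ↔ r a x y ∧ ¬ r b x y) ∧
    (∀ a b x y, r (A.rest a b) x y ↔ (∃ z, r a x z) ∧ r b x y) ∧
    (∀ a b x y, r (A.meet a b) x y ↔ r a x y ∧ r b x y) ∧
    (∀ x y, ¬ r A.bot x y) := by
  obtain ⟨X, Y, r, hi, hp, hd, hr⟩ := A.representable
  have hm : ∀ a b, r (A.meet a b) = r a ∩ r b := by
    intro a b
    simp [meet, hd]
  refine ⟨X, Y, fun a x y => (x, y) ∈ r a, ?_, ?_, ?_, ?_, ?_, ?_⟩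
  · intro a b
    rw [le_def, ← hi.eq_iff, hm, Set.inter_eq_left]
    exact ⟨fun h x y hx => h hx, fun h p hx => h p.1 p.2 hx⟩
  · exact fun a => hp a
  · simp [hd]
  · simp [hr, domRestrict, pairsDom]
  · simp [hm]
  · simp [bot, hd]

variable {A}

theorem bot_le (a : A) : A.bot ≤ a := by
  obtain ⟨X, Y, r, hl, hp, hd, hr, hm, h0⟩ := A.exists_rep
  grind

theorem isBot_iff {a : A} : IsBot a ↔ a = A.bot :=
  ⟨fun h => le_antisymm (h _) (bot_le a), fun h => h ▸ bot_le⟩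

theorem meet_le_left (a b : A) : A.meet a b ≤ a := by
  obtain ⟨X, Y, r, hl, hp, hd, hr, hm, h0⟩ := A.exists_rep
  grind

theorem meet_le_right (a b : A) : A.meet a b ≤ b := by
  obtain ⟨X, Y, r, hl, hp, hd, hr, hm, h0⟩ := A.exists_rep
  grind

theorem le_meet {a b c : A} (h : c ≤ a) (h' : c ≤ b) : c ≤ A.meet a b := by
  obtain ⟨X, Y, r, hl, hp, hd, hr, hm, h0⟩ := A.exists_rep
  grind

theorem diff_le (a b : A) : A.diff a b ≤ a := by
  obtain ⟨X, Y, r, hl, hp, hd, hr, hm, h0⟩ := A.exists_rep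
  grind

theorem meet_diff_self (a b : A) : A.meet (A.diff a b) b = A.bot := by
  obtain ⟨X, Y, r, hl, hp, hd, hr, hm, h0⟩ := A.exists_rep
  apply le_antisymm <;> grind

theorem le_diff {a b c : A} (h : c ≤ a) (h' : A.meet c b = A.bot) : c ≤ A.diff a b := by
  obtain ⟨X, Y, r, hl, hp, hd, hr, hm, h0⟩ := A.exists_rep
  have k := hm c b
  rw [h'] at k
  rw [hl] at *
  grind

theorem diff_eq_bot {a b : A} (h : A.diff a b = A.bot) : a ≤ b := by
  obtain ⟨X, Y, r, hl, hp, hd, hr, hm, h0⟩ := A.exists_rep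
  have k := hd a b
  rw [h] at k
  rw [hl] at *
  grind

theorem isLUB_meet_diff (a b : A) : IsLUB {A.meet a b, A.diff a b} a := by
  obtain ⟨X, Y, r, hl, hp, hd, hr, hm, h0⟩ := A.exists_rep
  constructor
  · rintro c (rfl | rfl)
    · exact meet_le_left _ _
    · exact diff_le _ _
  · intro c hc
    have h1 : A.meet a b ≤ c := hc (by simp)
    have h2 : A.diff a b ≤ c := hc (by simp)
    rw [hl] at *
    grind

theorem rest_le (a b : A) : A.rest a b ≤ b := by
  obtain ⟨X, Y, r, hl, hp, hd, hr, hm, h0⟩ := A.exists_rep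
  grind

theorem meet_le_rest (a b : A) : A.meet a b ≤ A.rest a b := by
  obtain ⟨X, Y, r, hl, hp, hd, hr, hm, h0⟩ := A.exists_rep
  grind

theorem rest_rest_le (a b c : A) : A.rest (A.rest a b) c ≤ A.rest a c := by
  obtain ⟨X, Y, r, hl, hp, hd, hr, hm, h0⟩ := A.exists_rep
  grind

theorem rest_eq_of_le {a b : A} (h : b ≤ a) : A.rest b a = b := by
  obtain ⟨X, Y, r, hl, hp, hd, hr, hm, h0⟩ := A.exists_rep
  apply le_antisymm <;> grind

theorem Compat.rest_le {a b : A} (h : A.Compat a b) : A.rest a b ≤ a := by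
  rw [h]
  exact DRA.rest_le b a

theorem rest_diff_rest_left (a b : A) : A.rest a (A.diff b (A.rest a b)) = A.bot := by
  obtain ⟨X, Y, r, hl, hp, hd, hr, hm, h0⟩ := A.exists_rep
  apply le_antisymm <;> grind

theorem rest_eq_bot_symm {a b : A} (h : A.rest a b = A.bot) : A.rest b a = A.bot := by
  obtain ⟨X, Y, r, hl, hp, hd, hr, hm, h0⟩ := A.exists_rep
  have h' := fun x y => hr a b x y
  rw [h] at h'
  apply le_antisymm <;> grind

theorem meet_rest_of_rest_eq_bot {a b c : A} (h : A.rest b c = A.bot) :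
    A.meet b (A.rest c a) = A.bot := by
  obtain ⟨X, Y, r, hl, hp, hd, hr, hm, h0⟩ := A.exists_rep
  have h' := fun x y => hr b c x y
  rw [h] at h'
  apply le_antisymm <;> grind

theorem rest_meet_le_meet (a b c : A) :
    A.rest (A.meet a b) c ≤ A.meet (A.rest a c) (A.rest b c) := by
  obtain ⟨X, Y, r, hl, hp, hd, hr, hm, h0⟩ := A.exists_rep
  grind

/-- Single-valuedness: where `a ∩ b` is defined, the value of `b` is the common value. -/
theorem rest_meet_le (a b : A) : A.rest (A.meet a b) b ≤ a := by
  obtain ⟨X, Y, r, hl, hp, hd, hr, hm, h0⟩ := A.exists_rep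
  rw [hl]
  intro x y h
  rw [hr] at h
  obtain ⟨⟨z, hz⟩, hb⟩ := h
  rw [hm] at hz
  exact hp _ _ _ _ hz.2 hb ▸ hz.1

/-- This and the next inequality are the two cases, agreement or not of `c` with `e`, that decide
the membership of `e` in the filter built in `exists_equivalent`. -/
theorem rest_le_of_rest_meet (a b c e : A) :
    A.rest (A.meet b (A.rest (A.meet c e) a)) c ≤ e := by
  obtain ⟨X, Y, r, hl, hp, hd, hr, hm, h0⟩ := A.exists_rep
  rw [hl]
  intro x y h
  rw [hr] at h
  obtain ⟨⟨z, hz⟩, hc⟩ := h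
  rw [hm, hr] at hz
  obtain ⟨-, ⟨w, hw⟩, -⟩ := hz
  rw [hm] at hw
  exact hp _ _ _ _ hw.1 hc ▸ hw.2

theorem rest_le_diff_of_rest_le {a b c d e : A} (h : A.rest b c ≤ d) :
    A.rest (A.meet b (A.diff a (A.rest (A.meet c e) a))) c ≤ A.diff d e := by
  obtain ⟨X, Y, r, hl, hp, hd, hr, hm, h0⟩ := A.exists_rep
  rw [hl] at *
  intro x y hxy
  rw [hr] at hxy
  obtain ⟨⟨z, hz⟩, hc⟩ := hxy
  rw [hm, hd, hr] at hz
  rw [hd]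
  refine ⟨h x y ((hr _ _ _ _).2 ⟨⟨z, hz.1⟩, hc⟩),
    fun he => hz.2.2 ⟨⟨y, (hm _ _ _ _).2 ⟨hc, he⟩⟩, hz.2.1⟩⟩

theorem rest_meet_le_rest {b b' c d : A} (h : A.rest b' c ≤ d) :
    A.rest (A.meet b b') c ≤ A.rest b d := by
  obtain ⟨X, Y, r, hl, hp, hd, hr, hm, h0⟩ := A.exists_rep
  rw [hl] at *
  grind

theorem meet_le_rest_of_rest_le {a b b' c d : A} (h : A.rest b' c ≤ d) :
    A.meet b (A.meet b' (A.rest c a)) ≤ A.rest d b := by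
  obtain ⟨X, Y, r, hl, hp, hd, hr, hm, h0⟩ := A.exists_rep
  have k := hr b' c
  rw [hl] at *
  grind

theorem Hom.map_meet {A B : DRA.{u}} (h : Hom A B) (a b : A) :
    h.toFun (A.meet a b) = B.meet (h.toFun a) (h.toFun b) := by
  rw [meet, h.map_diff, h.map_diff]
  rfl

theorem Hom.mono {A B : DRA.{u}} (h : Hom A B) {a b : A} (hab : a ≤ b) :
    h.toFun a ≤ h.toFun b := by
  rw [le_def, ← h.map_meet, hab]

theorem diff_self (a : A) : A.diff a a = A.bot := by
  obtain ⟨X, Y, r, hl, hp, hd, hr, hm, h0⟩ := A.exists_rep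
  apply le_antisymm <;> grind

theorem Hom.map_bot {A B : DRA.{u}} (h : Hom A B) : h.toFun A.bot = B.bot := by
  rw [← diff_self A.bot, h.map_diff, diff_self]

end Algebra

end DRA

/-! ### Filters -/

section Filters

variable {A : DRA.{u}}

theorem isPFilter_iff {F : Set A} : Order.IsPFilter F ↔
    F.Nonempty ∧ (∀ a b, a ≤ b → a ∈ F → b ∈ F) ∧ ∀ a ∈ F, ∀ b ∈ F, A.meet a b ∈ F := by
  constructor
  · intro h
    let G := h.toPFilter
    have hG : (G : Set A) = F := rfl
    have hu : ∀ a b, a ≤ b → a ∈ F → b ∈ F := fun a b => G.mem_of_le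
    refine ⟨G.nonempty, hu, fun a ha b hb => ?_⟩
    obtain ⟨c, hc, hca, hcb⟩ := G.directed a ha b hb
    exact hu _ _ (DRA.le_meet hca hcb) hc
  · rintro ⟨h1, h2, h3⟩
    exact Order.IsPFilter.of_def h1
      (fun a ha b hb => ⟨_, h3 a ha b hb, DRA.meet_le_left a b, DRA.meet_le_right a b⟩)
      (fun hab ha => h2 _ _ hab ha)

theorem ne_univ_iff_bot_notMem {F : Set A} (hF : Order.IsPFilter F) :
    F ≠ Set.univ ↔ A.bot ∉ F := by
  refine ⟨fun h h' => h (Set.eq_univ_of_forall fun a => ?_), fun h h' => h (h' ▸ trivial)⟩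
  exact (isPFilter_iff.1 hF).2.1 _ _ (DRA.bot_le a) h'

/-- The filter generated by a filter and an element. -/
theorem isPFilter_adjoin {F : Set A} (hF : Order.IsPFilter F) (b : A) :
    Order.IsPFilter {c | ∃ f ∈ F, A.meet f b ≤ c} := by
  rw [isPFilter_iff] at *
  obtain ⟨⟨a, ha⟩, hu, hm⟩ := hF
  refine ⟨⟨_, a, ha, le_rfl⟩, fun c d hcd ⟨f, hf, h⟩ => ⟨f, hf, h.trans hcd⟩, ?_⟩
  rintro c ⟨f, hf, h⟩ d ⟨g, hg, h'⟩
  refine ⟨_, hm f hf g hg, DRA.le_meet (le_trans ?_ h) (le_trans ?_ h')⟩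
  · exact DRA.le_meet ((DRA.meet_le_left _ _).trans (DRA.meet_le_left _ _)) (DRA.meet_le_right _ _)
  · exact DRA.le_meet ((DRA.meet_le_left _ _).trans (DRA.meet_le_right _ _)) (DRA.meet_le_right _ _)

theorem subset_adjoin (F : Set A) (b : A) : F ⊆ {c | ∃ f ∈ F, A.meet f b ≤ c} :=
  fun f hf => ⟨f, hf, DRA.meet_le_left _ _⟩

theorem mem_adjoin {F : Set A} (hF : F.Nonempty) (b : A) : b ∈ {c | ∃ f ∈ F, A.meet f b ≤ c} :=
  hF.elim fun f hf => ⟨f, hf, DRA.meet_le_right _ _⟩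

/-- The maximal filters are the proper filters that split every relative complement. -/
theorem maximal_isPFilter_iff {F : Set A} :
    Maximal (fun G : Set A => Order.IsPFilter G ∧ G ≠ Set.univ) F ↔
    Order.IsPFilter F ∧ A.bot ∉ F ∧ ∀ a ∈ F, ∀ b, b ∈ F ∨ A.diff a b ∈ F := by
  constructor
  · rintro ⟨⟨hF, hne⟩, hmax⟩
    have h0 := (ne_univ_iff_bot_notMem hF).1 hne
    obtain ⟨hn, hu, hm⟩ := isPFilter_iff.1 hF
    refine ⟨hF, h0, fun a ha b => or_iff_not_imp_left.2 fun hb => ?_⟩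
    have hG := isPFilter_adjoin hF b
    -- If `b` is missing from `F`, adjoining it must give an improper filter; an `f` disjoint from
    -- `b` then puts `a ∩ f` below `a - b`.
    have h : A.bot ∈ {c | ∃ f ∈ F, A.meet f b ≤ c} := by
      by_contra h
      exact hb (hmax ⟨hG, (ne_univ_iff_bot_notMem hG).2 h⟩ (subset_adjoin F b) (mem_adjoin hn b))
    obtain ⟨f, hf, h⟩ := h
    refine hu _ _ (DRA.le_diff (DRA.meet_le_left a f) ?_) (hm a ha f hf)
    refine le_antisymm (le_trans ?_ h) (DRA.bot_le _)
    exact DRA.le_meet ((DRA.meet_le_left _ _).trans (DRA.meet_le_right _ _)) (DRA.meet_le_right _ _)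
  · rintro ⟨hF, h0, hs⟩
    refine ⟨⟨hF, (ne_univ_iff_bot_notMem hF).2 h0⟩, ?_⟩
    rintro G ⟨hG, hne⟩ hFG b hb
    obtain ⟨⟨a, ha⟩, -, -⟩ := isPFilter_iff.1 hF
    refine (hs a ha b).resolve_right fun h => (ne_univ_iff_bot_notMem hG).1 hne ?_
    rw [← DRA.meet_diff_self a b]
    exact (isPFilter_iff.1 hG).2.2 _ (hFG h) _ hb

/-- A filter that avoids an ideal extends to a maximal filter that avoids it. -/
theorem exists_maxFilter {F I : Set A} (hF : Order.IsPFilter F) (h0 : A.bot ∈ I)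
    (hd : ∀ a b, a ≤ b → b ∈ I → a ∈ I) (hj : ∀ a b c, IsLUB {a, b} c → a ∈ I → b ∈ I → c ∈ I)
    (hFI : Disjoint F I) : ∃ μ : MaxFilter A, F ⊆ μ.1 ∧ Disjoint μ.1 I := by
  obtain ⟨G, hFG, hG⟩ := zorn_subset_nonempty {G : Set A | Order.IsPFilter G ∧ Disjoint G I} (by
    intro c hc hchain hne
    refine ⟨⋃₀ c, ⟨?_, ?_⟩, fun s hs => Set.subset_sUnion_of_mem hs⟩
    · rw [isPFilter_iff]
      refine ⟨?_, ?_, ?_⟩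
      · obtain ⟨G, hG⟩ := hne
        exact (isPFilter_iff.1 (hc hG).1).1.mono (Set.subset_sUnion_of_mem hG)
      · rintro a b hab ⟨G, hG, ha⟩
        exact ⟨G, hG, (isPFilter_iff.1 (hc hG).1).2.1 a b hab ha⟩
      · rintro a ⟨G, hG, ha⟩ b ⟨H, hH, hb⟩
        obtain h | h := hchain.total hG hH
        · exact ⟨H, hH, (isPFilter_iff.1 (hc hH).1).2.2 a (h ha) b hb⟩
        · exact ⟨G, hG, (isPFilter_iff.1 (hc hG).1).2.2 a ha b (h hb)⟩
    · rw [Set.disjoint_sUnion_left]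
      exact fun G hG => (hc hG).2) F ⟨hF, hFI⟩
  obtain ⟨⟨hGf, hGI⟩, hmax⟩ := hG
  obtain ⟨hn, hu, hm⟩ := isPFilter_iff.1 hGf
  -- Maximality of `G` is only among filters avoiding `I`; this is its usable form.
  have key : ∀ b ∉ G, ∃ f ∈ G, A.meet f b ∈ I := by
    intro b hb
    by_contra! h
    refine hb (hmax ⟨isPFilter_adjoin hGf b, ?_⟩ (subset_adjoin G b) (mem_adjoin hn b))
    rw [Set.disjoint_left]
    rintro c ⟨f, hf, hc⟩ hcI
    exact h f hf (hd _ _ hc hcI)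
  refine ⟨⟨G, maximal_isPFilter_iff.2 ⟨hGf, fun h => Set.disjoint_left.1 hGI h h0, ?_⟩⟩, hFG, hGI⟩
  intro a ha b
  by_contra! h
  obtain ⟨f, hf, hfI⟩ := key _ h.1
  obtain ⟨g, hg, hgI⟩ := key _ h.2
  have hk := hm a ha _ (hm f hf g hg)
  have hka : A.meet a (A.meet f g) ≤ a := DRA.meet_le_left _ _
  have hkf : A.meet a (A.meet f g) ≤ f := (DRA.meet_le_right _ _).trans (DRA.meet_le_left _ _)
  have hkg : A.meet a (A.meet f g) ≤ g := (DRA.meet_le_right _ _).trans (DRA.meet_le_right _ _)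
  -- The element `k` is the join of `k ∩ b` and `k - b`. These lie below `f ∩ b` and `g ∩ (a - b)`,
  -- hence in `I`, so `k` would lie in both `G` and `I`.
  generalize A.meet a (A.meet f g) = k at hk hka hkf hkg
  refine Set.disjoint_left.1 hGI hk (hj _ _ _ (DRA.isLUB_meet_diff k b) (hd _ _ ?_ hfI)
    (hd _ _ ?_ hgI))
  · exact DRA.le_meet ((DRA.meet_le_left _ _).trans hkf) (DRA.meet_le_right _ _)
  · refine DRA.le_meet ((DRA.diff_le _ _).trans hkg) (DRA.le_diff ((DRA.diff_le _ _).trans hka) ?_)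
    exact DRA.meet_diff_self k b

theorem isPFilter_Ici (a : A) : Order.IsPFilter (Set.Ici a) :=
  isPFilter_iff.2 ⟨⟨a, Set.mem_Ici.2 le_rfl⟩, fun _ _ h h' => le_trans h' h,
    fun _ h _ h' => DRA.le_meet h h'⟩

end Filters

/-! ### Primality of maximal filters and separation of elements. -/

namespace MaxFilter

variable {A : DRA.{u}}

section

variable (μ : MaxFilter A)

theorem isPFilter : Order.IsPFilter μ.1 := (maximal_isPFilter_iff.1 μ.2).1

theorem nonempty : μ.1.Nonempty := (isPFilter_iff.1 μ.isPFilter).1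

theorem bot_notMem : A.bot ∉ μ.1 := (maximal_isPFilter_iff.1 μ.2).2.1

variable {μ}

theorem mem_of_le {a b : A} (h : a ≤ b) (ha : a ∈ μ.1) : b ∈ μ.1 :=
  (isPFilter_iff.1 μ.isPFilter).2.1 a b h ha

theorem meet_mem {a b : A} (ha : a ∈ μ.1) (hb : b ∈ μ.1) : A.meet a b ∈ μ.1 :=
  (isPFilter_iff.1 μ.isPFilter).2.2 a ha b hb

theorem mem_or_diff_mem {a : A} (ha : a ∈ μ.1) (b : A) : b ∈ μ.1 ∨ A.diff a b ∈ μ.1 :=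
  (maximal_isPFilter_iff.1 μ.2).2.2 a ha b

theorem notMem_of_diff_mem {a b : A} (h : A.diff a b ∈ μ.1) : b ∉ μ.1 := fun hb =>
  μ.bot_notMem (DRA.meet_diff_self a b ▸ meet_mem h hb)

theorem diff_mem_iff {a b : A} : A.diff a b ∈ μ.1 ↔ a ∈ μ.1 ∧ b ∉ μ.1 :=
  ⟨fun h => ⟨mem_of_le (DRA.diff_le a b) h, notMem_of_diff_mem h⟩,
    fun h => (mem_or_diff_mem h.1 b).resolve_left h.2⟩

theorem meet_mem_iff {a b : A} : A.meet a b ∈ μ.1 ↔ a ∈ μ.1 ∧ b ∈ μ.1 :=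
  ⟨fun h => ⟨mem_of_le (DRA.meet_le_left a b) h, mem_of_le (DRA.meet_le_right a b) h⟩,
    fun h => meet_mem h.1 h.2⟩

/-- Maximal filters are prime. -/
theorem mem_or_mem_of_isLUB {a b c : A} (h : IsLUB {a, b} c) (hc : c ∈ μ.1) :
    a ∈ μ.1 ∨ b ∈ μ.1 := by
  by_contra! hn
  have h1 : A.diff (A.diff c a) b ∈ μ.1 := diff_mem_iff.2 ⟨diff_mem_iff.2 ⟨hc, hn.1⟩, hn.2⟩
  set d := A.diff (A.diff c a) b
  -- The remainder `d` is disjoint from `a` and `b`, so `c - d` is still an upper bound of both.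
  have h2 : c ≤ A.diff c d := by
    apply h.2
    rintro e (rfl | rfl)
    · refine DRA.le_diff (h.1 (by simp)) (le_antisymm ?_ (DRA.bot_le _))
      rw [← DRA.meet_diff_self c e]
      exact DRA.le_meet ((DRA.meet_le_right _ _).trans (DRA.diff_le _ _)) (DRA.meet_le_left _ _)
    · refine DRA.le_diff (h.1 (by simp)) (le_antisymm ?_ (DRA.bot_le _))
      rw [← DRA.meet_diff_self (A.diff c a) e]
      exact DRA.le_meet (DRA.meet_le_right _ _) (DRA.meet_le_left _ _)
  exact notMem_of_diff_mem (mem_of_le h2 hc) h1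

theorem mem_of_isLUB {a b c : A} (h : IsLUB {a, b} c) : c ∈ μ.1 ↔ a ∈ μ.1 ∨ b ∈ μ.1 :=
  ⟨mem_or_mem_of_isLUB h, fun h' => h'.elim (mem_of_le (h.1 (by simp))) (mem_of_le (h.1 (by simp)))⟩

end

theorem eq_of_subset {μ ν : MaxFilter A} (h : μ.1 ⊆ ν.1) : μ = ν :=
  Subtype.ext (h.antisymm (μ.2.2 ν.2.1 h))

theorem exists_mem {a : A} (h : a ≠ A.bot) : ∃ μ : MaxFilter A, a ∈ μ.1 := by
  obtain ⟨μ, hμ, -⟩ := exists_maxFilter (I := {A.bot}) (isPFilter_Ici a) rfl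
    (fun a b hab hb => le_antisymm (hab.trans_eq hb) (DRA.bot_le a))
    (fun b c d hd hb hc => le_antisymm (hd.2 (by
      rintro e (rfl | rfl)
      exacts [hb.le, hc.le])) (DRA.bot_le d))
    (Set.disjoint_singleton_right.2 fun h' => h (le_antisymm h' (DRA.bot_le a)))
  exact ⟨μ, hμ (Set.mem_Ici.2 le_rfl)⟩

/-- If `a ≰ b`, then `a - b` is nonzero, and a maximal filter through it separates `a` from `b`. -/
theorem le_of_forall_mem {a b : A} (h : ∀ μ : MaxFilter A, a ∈ μ.1 → b ∈ μ.1) : a ≤ b := by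
  by_contra hab
  obtain ⟨μ, hμ⟩ := exists_mem fun h' => hab (DRA.diff_eq_bot h')
  exact (diff_mem_iff.1 hμ).2 (h μ (diff_mem_iff.1 hμ).1)

theorem eq_of_forall_mem_iff {a b : A} (h : ∀ μ : MaxFilter A, a ∈ μ.1 ↔ b ∈ μ.1) : a = b :=
  le_antisymm (le_of_forall_mem fun μ => (h μ).1) (le_of_forall_mem fun μ => (h μ).2)

/-! ### The equivalence of maximal filters -/

theorem Equivalent.refl (μ : MaxFilter A) : Equivalent μ μ :=
  have h : ∀ a ∈ μ.1, ∀ b ∈ μ.1, A.rest a b ∈ μ.1 := fun a ha b hb =>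
    mem_of_le (DRA.meet_le_rest a b) (meet_mem ha hb)
  ⟨h, h⟩

theorem Equivalent.symm {μ ν : MaxFilter A} (h : Equivalent μ ν) : Equivalent ν μ := ⟨h.2, h.1⟩

theorem Equivalent.trans {μ ν ρ : MaxFilter A} (h : Equivalent μ ν) (h' : Equivalent ν ρ) :
    Equivalent μ ρ := by
  obtain ⟨b, hb⟩ := ν.nonempty
  exact ⟨fun a ha c hc => mem_of_le (DRA.rest_rest_le a b c) (h'.1 _ (h.1 a ha b hb) c hc),
    fun c hc a ha => mem_of_le (DRA.rest_rest_le c b a) (h.2 _ (h'.2 c hc b hb) a ha)⟩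

/-- Equivalent maximal filters with a common element are equal. -/
theorem Equivalent.eq {μ ν : MaxFilter A} (h : Equivalent μ ν) {a : A} (hμ : a ∈ μ.1)
    (hν : a ∈ ν.1) : μ = ν := by
  refine eq_of_subset fun b hb => mem_of_le (DRA.meet_le_left b a) ?_
  rw [← DRA.rest_eq_of_le (DRA.meet_le_right b a)]
  exact h.1 _ (meet_mem hb hμ) a hν

/-- Inequivalent maximal filters contain elements with disjoint domains. -/
theorem exists_rest_eq_bot {μ ν : MaxFilter A} (h : ¬ Equivalent μ ν) :
    ∃ a ∈ μ.1, ∃ b ∈ ν.1, A.rest a b = A.bot := by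
  obtain h | h := not_and_or.1 h <;> push Not at h
  · obtain ⟨a, ha, b, hb, hab⟩ := h
    exact ⟨a, ha, _, diff_mem_iff.2 ⟨hb, hab⟩, DRA.rest_diff_rest_left a b⟩
  · obtain ⟨b, hb, a, ha, hab⟩ := h
    exact ⟨_, diff_mem_iff.2 ⟨ha, hab⟩, b, hb,
      DRA.rest_eq_bot_symm (DRA.rest_diff_rest_left b a)⟩

/-- A maximal filter containing an element whose domain is contained in that of `c` is equivalent
to one containing `c`. -/
theorem exists_equivalent {ξ : MaxFilter A} {a c : A} (h : A.rest c a ∈ ξ.1) :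
    ∃ ξ' : MaxFilter A, c ∈ ξ'.1 ∧ Equivalent ξ ξ' := by
  have ha : a ∈ ξ.1 := mem_of_le (DRA.rest_le c a) h
  -- Equivalence forces every `b ▹ c` with `b ∈ ξ` into the filter sought, so it can only be the
  -- filter these generate.
  have hmax : Maximal (fun G : Set A => Order.IsPFilter G ∧ G ≠ Set.univ)
      {d | ∃ b ∈ ξ.1, A.rest b c ≤ d} := by
    rw [maximal_isPFilter_iff, isPFilter_iff]
    refine ⟨⟨⟨c, a, ha, DRA.rest_le a c⟩, ?_, ?_⟩, ?_, ?_⟩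
    · rintro d e hde ⟨b, hb, hd⟩
      exact ⟨b, hb, hd.trans hde⟩
    · rintro d ⟨b, hb, hd⟩ d' ⟨b', hb', hd'⟩
      have := DRA.rest_meet_le_meet b b' c
      exact ⟨_, meet_mem hb hb', DRA.le_meet ((this.trans (DRA.meet_le_left _ _)).trans hd)
        ((this.trans (DRA.meet_le_right _ _)).trans hd')⟩
    · rintro ⟨b, hb, hd⟩
      apply ξ.bot_notMem
      rw [← DRA.meet_rest_of_rest_eq_bot (a := a) (le_antisymm hd (DRA.bot_le _))]
      exact meet_mem hb h
    · rintro d ⟨b, hb, hd⟩ e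
      -- `ξ` contains either the part of `a` over the points where `c` and `e` agree, or the rest of
      -- `a`; this settles `e` against `d - e`.
      obtain h' | h' := mem_or_diff_mem ha (A.rest (A.meet c e) a)
      · exact Or.inl ⟨_, meet_mem hb h', DRA.rest_le_of_rest_meet a b c e⟩
      · exact Or.inr ⟨_, meet_mem hb h', DRA.rest_le_diff_of_rest_le hd⟩
  refine ⟨⟨_, hmax⟩, ⟨a, ha, DRA.rest_le a c⟩, ?_, ?_⟩
  · rintro b hb d ⟨b', hb', hd⟩
    exact ⟨_, meet_mem hb hb', DRA.rest_meet_le_rest hd⟩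
  · rintro d ⟨b', hb', hd⟩ b hb
    exact mem_of_le (DRA.meet_le_rest_of_rest_le hd) (meet_mem hb (meet_mem hb' h))

/-- The geometric meaning of restriction: it cuts `b̂` down to the fibres that meet `â`. Openness of
the quotient map and preservation of restriction by the unit both come from this. -/
theorem rest_mem_iff {ξ : MaxFilter A} {a b : A} :
    A.rest a b ∈ ξ.1 ↔ b ∈ ξ.1 ∧ ∃ ξ' : MaxFilter A, a ∈ ξ'.1 ∧ Equivalent ξ ξ' := by
  refine ⟨fun h => ⟨mem_of_le (DRA.rest_le a b) h, exists_equivalent h⟩, ?_⟩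
  rintro ⟨hb, ξ', ha, h⟩
  exact h.2 a ha b hb

end MaxFilter

namespace MaxFilter

variable {A : DRA.{u}}

/-! ### The topology of the space of maximal filters -/

/-- The maximal filters containing a given element. -/
def basicOpen (a : A) : Set (MaxFilter A) := {μ | a ∈ μ.1}

@[simp] theorem mem_basicOpen {a : A} {μ : MaxFilter A} : μ ∈ basicOpen a ↔ a ∈ μ.1 := Iff.rfl

theorem isTopologicalBasis_basicOpen :
    TopologicalSpace.IsTopologicalBasis (Set.range (basicOpen (A := A))) where
  exists_subset_inter := by
    rintro _ ⟨a, rfl⟩ _ ⟨b, rfl⟩ μ hμ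
    exact ⟨_, ⟨A.meet a b, rfl⟩, meet_mem hμ.1 hμ.2, fun ν hν => meet_mem_iff.1 hν⟩
  sUnion_eq := Set.eq_univ_of_forall fun μ =>
    μ.nonempty.elim fun a ha => ⟨_, ⟨a, rfl⟩, ha⟩
  eq_generateFrom := rfl

theorem isOpen_basicOpen (a : A) : IsOpen (basicOpen a) :=
  isTopologicalBasis_basicOpen.isOpen ⟨a, rfl⟩

theorem exists_basicOpen_subset {U : Set (MaxFilter A)} (hU : IsOpen U) {μ : MaxFilter A}
    (hμ : μ ∈ U) : ∃ a ∈ μ.1, basicOpen a ⊆ U := by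
  obtain ⟨_, ⟨a, rfl⟩, ha, h⟩ := isTopologicalBasis_basicOpen.exists_subset_of_mem_open hμ hU
  exact ⟨a, ha, h⟩

theorem basicOpen_bot : basicOpen A.bot = ∅ :=
  Set.eq_empty_of_forall_notMem fun μ => μ.bot_notMem

theorem basicOpen_mono {a b : A} (h : a ≤ b) : basicOpen a ⊆ basicOpen b := fun _ => mem_of_le h

theorem basicOpen_of_isLUB {a b c : A} (h : IsLUB {a, b} c) :
    basicOpen c = basicOpen a ∪ basicOpen b :=
  Set.ext fun _ => mem_of_isLUB h

theorem basicOpen_diff (a b : A) : basicOpen (A.diff a b) = basicOpen a \ basicOpen b :=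
  Set.ext fun _ => diff_mem_iff

theorem basicOpen_injective : Function.Injective (basicOpen (A := A)) := fun _ _ h =>
  eq_of_forall_mem_iff fun μ => Set.ext_iff.1 h μ

/-- The elements whose basic set has a finite subcover form an ideal. If `a` were outside it, some
maximal filter through `a` would avoid it; but that filter lies in one `U i`, together with a basic
neighbourhood. -/
theorem isCompact_basicOpen (a : A) : IsCompact (basicOpen a) := by
  refine isCompact_of_finite_subcover fun {ι} U hU hcov => ?_
  by_contra! hfin
  obtain ⟨μ, hμ, hI⟩ := exists_maxFilter
    (I := {b : A | ∃ t : Finset ι, basicOpen b ⊆ ⋃ i ∈ t, U i}) (isPFilter_Ici a)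
    ⟨∅, by simp [basicOpen_bot]⟩
    (fun b c hbc ⟨t, ht⟩ => ⟨t, (basicOpen_mono hbc).trans ht⟩)
    (by
      classical
      rintro b c d hd ⟨t, ht⟩ ⟨s, hs⟩
      refine ⟨t ∪ s, ?_⟩
      rw [basicOpen_of_isLUB hd, Finset.set_biUnion_union]
      exact Set.union_subset_union ht hs)
    (by
      rw [Set.disjoint_left]
      rintro b hb ⟨t, ht⟩
      exact hfin t ((basicOpen_mono hb).trans ht))
  obtain ⟨i, hi⟩ := Set.mem_iUnion.1 (hcov (hμ (Set.mem_Ici.2 le_rfl) : μ ∈ basicOpen a))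
  obtain ⟨b, hb, hbU⟩ := exists_basicOpen_subset (hU i) hi
  exact Set.disjoint_left.1 hI hb ⟨{i}, by simpa using hbU⟩

theorem isCompact_and_isOpen_iff (U : Set (MaxFilter A)) :
    IsCompact U ∧ IsOpen U ↔ ∃ s : Set A, s.Finite ∧ U = ⋃ a ∈ s, basicOpen a :=
  isCompact_open_iff_eq_finite_iUnion_of_isTopologicalBasis _ isTopologicalBasis_basicOpen
    isCompact_basicOpen U

instance : T2Space (MaxFilter A) := by
  refine ⟨fun μ ν hne => ?_⟩
  obtain ⟨b, hb, hbμ⟩ : ∃ b ∈ ν.1, b ∉ μ.1 := Set.not_subset.1 fun h => hne (eq_of_subset h).symm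
  obtain ⟨a, ha⟩ := μ.nonempty
  refine ⟨_, _, isOpen_basicOpen (A.diff a b), isOpen_basicOpen b, diff_mem_iff.2 ⟨ha, hbμ⟩, hb, ?_⟩
  rw [basicOpen_diff]
  exact Set.disjoint_sdiff_left

theorem isClopen_basicOpen (a : A) : IsClopen (basicOpen a) :=
  ⟨(isCompact_basicOpen a).isClosed, isOpen_basicOpen a⟩

theorem isZeroDimensional (A : DRA.{u}) : IsZeroDimensional (MaxFilter A) := fun μ U hU => by
  obtain ⟨a, ha, h⟩ := exists_basicOpen_subset isOpen_interior (mem_interior_iff_mem_nhds.2 hU)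
  exact ⟨_, (isOpen_basicOpen a).mem_nhds ha, h.trans interior_subset, isClopen_basicOpen a⟩

instance : LocallyCompactSpace (MaxFilter A) := by
  refine ⟨fun μ U hU => ?_⟩
  obtain ⟨a, ha, h⟩ := exists_basicOpen_subset isOpen_interior (mem_interior_iff_mem_nhds.2 hU)
  exact ⟨_, (isOpen_basicOpen a).mem_nhds ha, h.trans interior_subset, isCompact_basicOpen a⟩

/-! ### The quotient by equivalence -/

/-- The equivalence of maximal filters as a setoid. -/
def equivalentSetoid (A : DRA.{u}) : Setoid (MaxFilter A) where
  r := Equivalent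
  iseqv := ⟨Equivalent.refl, Equivalent.symm, Equivalent.trans⟩

/-- The quotient map by equivalence. -/
def toQuotient (μ : MaxFilter A) : Quotient (equivalentSetoid A) := Quotient.mk _ μ

theorem toQuotient_eq_iff {μ ν : MaxFilter A} :
    toQuotient μ = toQuotient ν ↔ Equivalent μ ν :=
  Quotient.eq (r := equivalentSetoid A)

theorem continuous_toQuotient : Continuous (toQuotient (A := A)) := continuous_quotient_mk'

/-- By `rest_mem_iff`, the saturation of `â` is the union of the basic sets of all `a ▹ b`. -/
theorem isOpenMap_toQuotient : IsOpenMap (toQuotient (A := A)) := by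
  rw [isTopologicalBasis_basicOpen.isOpenMap_iff]
  rintro _ ⟨a, rfl⟩
  have h : toQuotient ⁻¹' (toQuotient '' basicOpen a) = ⋃ b : A, basicOpen (A.rest a b) := by
    ext ν
    simp only [Set.mem_preimage, Set.mem_image, toQuotient_eq_iff, Set.mem_iUnion, mem_basicOpen,
      rest_mem_iff]
    constructor
    · rintro ⟨μ, ha, h⟩
      obtain ⟨b, hb⟩ := ν.nonempty
      exact ⟨b, hb, μ, ha, h.symm⟩
    · rintro ⟨b, hb, μ, ha, h⟩
      exact ⟨μ, ha, h.symm⟩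
  change IsOpen (toQuotient ⁻¹' (toQuotient '' basicOpen a))
  rw [h]
  exact isOpen_iUnion fun b => isOpen_basicOpen _

theorem injOn_toQuotient (a : A) : Set.InjOn toQuotient (basicOpen a) := fun _ hμ _ hν h =>
  (toQuotient_eq_iff.1 h).eq hμ hν

theorem isLocalHomeomorph_toQuotient : IsLocalHomeomorph (toQuotient (A := A)) := by
  rw [isLocalHomeomorph_iff_isOpenEmbedding_restrict]
  intro μ
  obtain ⟨a, ha⟩ := μ.nonempty
  refine ⟨_, (isOpen_basicOpen a).mem_nhds ha, .of_continuous_injective_isOpenMap ?_ ?_ ?_⟩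
  · exact continuous_toQuotient.comp continuous_subtype_val
  · exact Set.injOn_iff_injective.1 (injOn_toQuotient a)
  · exact isOpenMap_toQuotient.domRestrict (isOpen_basicOpen a)

/-- Inequivalent filters contain elements with disjoint domains, and the basic sets of such elements
have no fibre in common. -/
instance : T2Space (Quotient (equivalentSetoid A)) := by
  refine ⟨fun x y => Quotient.inductionOn₂ x y fun μ ν hne => ?_⟩
  obtain ⟨a, ha, b, hb, hab⟩ := exists_rest_eq_bot fun h => hne (toQuotient_eq_iff.2 h)
  refine ⟨_, _, isOpenMap_toQuotient _ (isOpen_basicOpen a),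
    isOpenMap_toQuotient _ (isOpen_basicOpen b), ⟨μ, ha, rfl⟩, ⟨ν, hb, rfl⟩, ?_⟩
  rw [Set.disjoint_left]
  rintro _ ⟨ρ, hρ, rfl⟩ ⟨τ, hτ, h⟩
  exact τ.bot_notMem (hab ▸ (toQuotient_eq_iff.1 h).2 a hρ b hτ)

end MaxFilter

/-- The étale space of maximal filters of an algebra. -/
def DRA.spectrum (A : DRA.{u}) : HausEt.{u} where
  X := MaxFilter A
  X₀ := Quotient (MaxFilter.equivalentSetoid A)
  proj := MaxFilter.toQuotient
  surjective := Quotient.mk_surjective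
  localHomeo := MaxFilter.isLocalHomeomorph_toQuotient
  t2 := inferInstance
  t2_base := inferInstance

theorem DRA.lczd_spectrum (A : DRA.{u}) : lczd A.spectrum :=
  ⟨inferInstanceAs (LocallyCompactSpace (MaxFilter A)), MaxFilter.isZeroDimensional A⟩

/-! ### Inverse images of maximal filters under homomorphisms -/

namespace DRA.Hom

variable {A B : DRA.{u}} (h : Hom A B)

/-- The partial function taking inverse images of maximal filters, when these are maximal. -/
noncomputable def comap : MaxFilter B →. MaxFilter A := fun ξ =>
  ⟨Maximal (fun G : Set A => Order.IsPFilter G ∧ G ≠ Set.univ) (h.toFun ⁻¹' ξ.1), fun H => ⟨_, H⟩⟩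

theorem mem_comap {ξ : MaxFilter B} {μ : MaxFilter A} :
    μ ∈ h.comap ξ ↔ μ.1 = h.toFun ⁻¹' ξ.1 := by
  constructor
  · rintro ⟨H, rfl⟩
    rfl
  · intro H
    have hm := μ.2
    rw [H] at hm
    exact ⟨hm, Subtype.ext H.symm⟩

/-- The inverse image of a maximal filter is maximal as soon as it is nonempty. -/
theorem exists_mem_comap {ξ : MaxFilter B} {a : A} (ha : h.toFun a ∈ ξ.1) :
    ∃ μ ∈ h.comap ξ, a ∈ μ.1 := by
  have hm : Maximal (fun G : Set A => Order.IsPFilter G ∧ G ≠ Set.univ) (h.toFun ⁻¹' ξ.1) := by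
    rw [maximal_isPFilter_iff, isPFilter_iff]
    refine ⟨⟨⟨a, ha⟩, fun b c hbc hb => MaxFilter.mem_of_le (h.mono hbc) hb,
      fun b hb c hc => ?_⟩, ?_, fun b hb c => ?_⟩
    · rw [Set.mem_preimage, h.map_meet]
      exact MaxFilter.meet_mem hb hc
    · rw [Set.mem_preimage, h.map_bot]
      exact ξ.bot_notMem
    · rw [Set.mem_preimage, Set.mem_preimage, h.map_diff]
      exact MaxFilter.mem_or_diff_mem hb _
  exact ⟨⟨_, hm⟩, (mem_comap h).2 rfl, ha⟩

/-- If `h a ∈ ξ`, the inverse image of `ξ` contains `a`, hence is maximal and `comap` is defined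
there. This gives continuity and also the naturality of the unit. -/
theorem preimage_comap_basicOpen (a : A) :
    h.comap.preimage (MaxFilter.basicOpen a) = MaxFilter.basicOpen (h.toFun a) := by
  ext ξ
  rw [PFun.mem_preimage]
  constructor
  · rintro ⟨μ, ha, hμ⟩
    exact (Set.ext_iff.1 ((mem_comap h).1 hμ) a).1 ha
  · intro ha
    obtain ⟨μ, hμ, h'⟩ := h.exists_mem_comap ha
    exact ⟨μ, h', hμ⟩

theorem mem_of_mem_comap {ξ : MaxFilter B} {μ : MaxFilter A} (hμ : μ ∈ h.comap ξ) {a : A} :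
    a ∈ μ.1 ↔ h.toFun a ∈ ξ.1 :=
  Set.ext_iff.1 ((mem_comap h).1 hμ) a

/-- Only the domains need care: if the inverse image under the composite is nonempty, so is the
intermediate one, which is therefore maximal. -/
theorem mem_comap_comp {A B C : DRA.{u}} (h : A ⟶ B) (k : B ⟶ C) {ξ : MaxFilter C}
    {μ : MaxFilter A} :
    μ ∈ Hom.comap (h ≫ k) ξ ↔ ∃ ν ∈ Hom.comap k ξ, μ ∈ Hom.comap h ν := by
  constructor
  · intro hμ
    obtain ⟨a, ha⟩ := μ.nonempty
    obtain ⟨ν, hν, -⟩ := exists_mem_comap k ((mem_of_mem_comap _ hμ).1 ha)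
    exact ⟨ν, hν, (mem_comap h).2 (((mem_comap _).1 hμ).trans
      (congrArg (Set.preimage h.toFun) ((mem_comap k).1 hν).symm))⟩
  · rintro ⟨ν, hν, hμ⟩
    exact (mem_comap _).2 (((mem_comap h).1 hμ).trans
      (congrArg (Set.preimage h.toFun) ((mem_comap k).1 hν)))

theorem pcontinuous_comap : PContinuous h.comap := by
  intro U hU
  rw [MaxFilter.isTopologicalBasis_basicOpen.open_eq_sUnion' hU, Set.sUnion_eq_biUnion]
  have : ∀ s : Set (Set (MaxFilter A)), h.comap.preimage (⋃ V ∈ s, V)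
      = ⋃ V ∈ s, h.comap.preimage V := by
    intro s
    ext ξ
    simp only [PFun.mem_preimage, Set.mem_iUnion]
    exact ⟨fun ⟨μ, ⟨V, hV, hμ⟩, h'⟩ => ⟨V, hV, μ, hμ, h'⟩,
      fun ⟨V, hV, μ, hμ, h'⟩ => ⟨μ, ⟨V, hV, hμ⟩, h'⟩⟩
  rw [this]
  refine isOpen_biUnion ?_
  rintro _ ⟨⟨a, rfl⟩, -⟩
  rw [preimage_comap_basicOpen]
  exact MaxFilter.isOpen_basicOpen _

/-- Finitely many sets `â` cover `K`. On the compact union of the basic sets of the `h a`, `comap`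
is defined everywhere, so the preimage of `K` is what remains after removing the open preimage of
the complement. -/
theorem isCompact_preimage_comap {K : Set (MaxFilter A)} (hK : IsCompact K) :
    IsCompact (h.comap.preimage K) := by
  obtain ⟨t, hcov⟩ := hK.elim_finite_subcover (MaxFilter.basicOpen (A := A))
    MaxFilter.isOpen_basicOpen fun μ _ =>
      μ.nonempty.elim fun a ha => Set.mem_iUnion.2 ⟨a, ha⟩
  have hc : IsCompact (⋃ a ∈ t, MaxFilter.basicOpen (h.toFun a)) :=
    t.isCompact_biUnion fun a _ => MaxFilter.isCompact_basicOpen _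
  have : h.comap.preimage K
      = (⋃ a ∈ t, MaxFilter.basicOpen (h.toFun a)) \ h.comap.preimage Kᶜ := by
    ext ξ
    constructor
    · rintro ⟨μ, hμ, h'⟩
      refine ⟨?_, fun ⟨ν, hν, h''⟩ => hν (Part.mem_unique h' h'' ▸ hμ)⟩
      obtain ⟨a, hat, ha⟩ := Set.mem_iUnion₂.1 (hcov hμ)
      exact Set.mem_iUnion₂.2 ⟨a, hat, (h.mem_of_mem_comap h').1 ha⟩
    · rintro ⟨hξ, hn⟩
      obtain ⟨a, hat, ha⟩ := Set.mem_iUnion₂.1 hξ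
      obtain ⟨μ, hμ, -⟩ := h.exists_mem_comap ha
      exact ⟨μ, not_not.1 fun hK => hn ⟨μ, hK, hμ⟩, hμ⟩
  rw [this]
  exact hc.diff (h.pcontinuous_comap _ hK.isClosed.isOpen_compl)

/-- The morphism of étale spaces induced by a homomorphism. -/
noncomputable def spectrumMap : HausEt.Hom B.spectrum A.spectrum where
  toPFun := h.comap
  continuous := h.pcontinuous_comap
  proper _ := h.isCompact_preimage_comap
  preserves := by
    intro ξ ξ' μ μ' hμ hμ' e
    replace e := MaxFilter.toQuotient_eq_iff.1 e
    refine MaxFilter.toQuotient_eq_iff.2 ⟨fun a ha b hb => ?_, fun b hb a ha => ?_⟩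
    · rw [h.mem_of_mem_comap hμ] at ha
      rw [h.mem_of_mem_comap hμ'] at hb ⊢
      rw [h.map_rest]
      exact e.1 _ ha _ hb
    · rw [h.mem_of_mem_comap hμ] at ha ⊢
      rw [h.mem_of_mem_comap hμ'] at hb
      rw [h.map_rest]
      exact e.2 _ hb _ ha
  fibre_injective := by
    intro ξ ξ' μ hμ hμ' e
    obtain ⟨a, ha⟩ := μ.nonempty
    exact (MaxFilter.toQuotient_eq_iff.1 e).eq ((h.mem_of_mem_comap hμ).1 ha)
      ((h.mem_of_mem_comap hμ').1 ha)
  fibre_surjective := by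
    intro ξ μ ν hμ e
    replace e := MaxFilter.toQuotient_eq_iff.1 e
    obtain ⟨a, ha⟩ := μ.nonempty
    obtain ⟨c, hc⟩ := ν.nonempty
    have hca : B.rest (h.toFun c) (h.toFun a) ∈ ξ.1 := by
      rw [← h.map_rest, ← h.mem_of_mem_comap hμ]
      exact e.1 c hc a ha
    -- Moving `ξ` along its fibre to a filter through `h c` makes the inverse image defined there;
    -- it remains to identify that image with `ν`.
    obtain ⟨ξ', hξ', e'⟩ := MaxFilter.exists_equivalent hca
    obtain ⟨ν', hν', hcν'⟩ := h.exists_mem_comap hξ'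
    refine ⟨ξ', MaxFilter.toQuotient_eq_iff.2 e'.symm, ?_⟩
    have : ν = ν' := by
      refine MaxFilter.eq_of_subset fun d hd => ?_
      -- For `d ∈ ν`, the domain of `d ∩ c` is carried from `ν` to `μ`, then through `h` to `ξ` and
      -- `ξ'`, where restricting `c` to it gives an element below `d`.
      have h1 : A.rest (A.meet d c) a ∈ μ.1 := e.1 _ (MaxFilter.meet_mem hd hc) a ha
      rw [h.mem_of_mem_comap hμ] at h1
      have h2 : h.toFun (A.rest (A.rest (A.meet d c) a) c) ∈ ξ'.1 := by
        rw [h.map_rest]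
        exact e'.1 _ h1 _ hξ'
      rw [← h.mem_of_mem_comap hν'] at h2
      refine MaxFilter.mem_of_le ((DRA.rest_rest_le _ _ _).trans ?_) h2
      exact DRA.rest_meet_le d c
    exact this ▸ hν'

end DRA.Hom

/-- The functor taking an algebra to its étale space of maximal filters. -/
noncomputable def spectrumFunctor : DRA.{u}ᵒᵖ ⥤ HausEt.{u} where
  obj A := A.unop.spectrum
  map h := DRA.Hom.spectrumMap h.unop
  map_id A := HausEt.Hom.ext (PFun.ext fun ξ μ => by
    refine (DRA.Hom.mem_comap _).trans (Iff.trans ?_ (Part.mem_some_iff).symm)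
    exact Subtype.ext_iff.symm)
  map_comp f g := HausEt.Hom.ext (PFun.ext fun ξ μ => by
    refine (DRA.Hom.mem_comap _).trans (Iff.trans ?_ (Part.mem_bind_iff).symm)
    exact (DRA.Hom.mem_comap _).symm.trans (DRA.Hom.mem_comap_comp g.unop f.unop))

/-! ### The algebra of compact open sections -/

theorem PFun.preimage_diff {X Y : Type*} (φ : X →. Y) (U V : Set Y) :
    φ.preimage (U \ V) = φ.preimage U \ φ.preimage V := by
  ext x
  simp only [PFun.mem_preimage, Set.mem_sdiff]
  constructor
  · rintro ⟨y, hy, h⟩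
    exact ⟨⟨y, hy.1, h⟩, fun ⟨z, hz, h'⟩ => hy.2 (Part.mem_unique h h' ▸ hz)⟩
  · rintro ⟨⟨y, hy, h⟩, hn⟩
    exact ⟨y, ⟨hy, fun hV => hn ⟨y, hV, h⟩⟩, h⟩

theorem PFun.preimage_some {X Y : Type*} (e : X → Y) (V : Set Y) :
    PFun.preimage (fun x => Part.some (e x)) V = e ⁻¹' V :=
  Set.ext fun _ => ⟨fun ⟨_, hy, h⟩ => Set.mem_preimage.2 (Part.mem_some_iff.1 h ▸ hy),
    fun h => ⟨_, h, Part.mem_some _⟩⟩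

namespace HausEt

section

variable (P : HausEt.{u})

/-- Since the base is Hausdorff, the compact image of `U` is closed, so a closed subset is cut out
of the compact set `V`. -/
theorem isCompact_restrict (U V : CompactOpenSections P) :
    IsCompact (P.proj ⁻¹' (P.proj '' U.1) ∩ V.1) := by
  rw [Set.inter_comm]
  exact V.2.1.inter_right
    ((U.2.1.image P.localHomeo.continuous).isClosed.preimage P.localHomeo.continuous)

theorem isOpen_restrict (U V : CompactOpenSections P) :
    IsOpen (P.proj ⁻¹' (P.proj '' U.1) ∩ V.1) :=
  ((P.localHomeo.isOpenMap _ U.2.2.1).preimage P.localHomeo.continuous).inter V.2.2.1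

/-- The compact open sections of an étale space, with relative complement and restriction. -/
def sections : DRA.{u} where
  carrier := CompactOpenSections P
  diff U V := ⟨U.1 \ V.1, U.2.1.diff V.2.2.1, U.2.2.1.sdiff V.2.1.isClosed,
    U.2.2.2.mono Set.sdiff_subset⟩
  rest U V := ⟨P.proj ⁻¹' (P.proj '' U.1) ∩ V.1, P.isCompact_restrict U V, P.isOpen_restrict U V,
    V.2.2.2.mono Set.inter_subset_right⟩
  nonempty := ⟨⟨∅, isCompact_empty, isOpen_empty, Set.injOn_empty _⟩⟩
  representable := by
    -- A section `U` is represented by the partial inverse of the projection with image `U`.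
    refine ⟨P.X₀, P.X, fun U => {p | p.2 ∈ U.1 ∧ P.proj p.2 = p.1}, ?_, ?_, ?_, ?_⟩
    · intro U V h
      refine Subtype.ext (Set.ext fun x => ?_)
      simpa using Set.ext_iff.1 h (P.proj x, x)
    · rintro U z x y ⟨hx, hxz⟩ ⟨hy, hyz⟩
      exact U.2.2.2 hx hy (hxz.trans hyz.symm)
    · rintro U V
      ext ⟨z, x⟩
      simp only [Set.mem_sdiff, Set.mem_ofPred_eq]
      tauto
    · rintro U V
      ext ⟨z, x⟩
      simp only [domRestrict, pairsDom, Set.mem_inter_iff, Set.mem_preimage, Set.mem_image,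
        Set.mem_ofPred_eq]
      constructor
      · rintro ⟨⟨⟨y, hy, hyx⟩, hx⟩, rfl⟩
        exact ⟨⟨y, hy, hyx⟩, hx, rfl⟩
      · rintro ⟨⟨y, hy, hyx⟩, hx, rfl⟩
        exact ⟨⟨⟨y, hy, hyx⟩, hx⟩, rfl⟩

variable {P}

theorem sections_meet (U V : P.sections) : (P.sections.meet U V).1 = U.1 ∩ V.1 :=
  Set.ext fun _ => ⟨fun h => ⟨h.1, not_not.1 fun hV => h.2 ⟨h.1, hV⟩⟩,
    fun h => ⟨h.1, fun h' => h'.2 h.2⟩⟩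

theorem sections_le_iff {U V : P.sections} : U ≤ V ↔ U.1 ⊆ V.1 := by
  rw [DRA.le_def]
  refine Subtype.ext_iff.trans ?_
  rw [sections_meet, Set.inter_eq_left]

theorem sections_bot : (DRA.bot P.sections).1 = ∅ := Set.sdiff_self

theorem sections_isBot_iff {U : P.sections} : IsBot U ↔ U.1 = ∅ := by
  rw [DRA.isBot_iff]
  refine Subtype.ext_iff.trans ?_
  rw [sections_bot]

/-- Compatibility of sections is thus what keeps the projection injective on their union. -/
theorem sections_compat_iff {U V : P.sections} :
    P.sections.Compat U V ↔ ∀ x ∈ U.1, ∀ y ∈ V.1, P.PtCompat x y := by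
  constructor
  · intro h x hx y hy e
    have h := congrArg Subtype.val h
    have hy' : y ∈ (P.sections.rest V U).1 := h ▸ ⟨⟨x, hx, e⟩, hy⟩
    exact U.2.2.2 hx hy'.2 e
  · intro h
    refine Subtype.ext (Set.ext fun z => ⟨?_, ?_⟩)
    · rintro ⟨⟨x, hx, e⟩, hz⟩
      have := h x hx z hz e
      exact this ▸ ⟨⟨z, hz, e.symm⟩, hx⟩
    · rintro ⟨⟨x, hx, e⟩, hz⟩
      have := h z hz x hx e.symm
      exact this ▸ ⟨⟨z, hz, e.symm⟩, hx⟩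

theorem sections_isLUB {S : Set P.sections} (W : P.sections) (hW : W.1 = ⋃ U ∈ S, U.1) :
    IsLUB S W := by
  refine ⟨fun U hU => ?_, fun V hV => ?_⟩
  · rw [sections_le_iff, hW]
    exact Set.subset_biUnion_of_mem hU
  · rw [sections_le_iff, hW]
    exact Set.iUnion₂_subset fun U hU => sections_le_iff.1 (hV hU)

/-- Binary joins of sections are unions. -/
theorem sections_isLUB_pair_iff {U V W : P.sections} :
    IsLUB {U, V} W ↔ W.1 = U.1 ∪ V.1 := by
  constructor
  · intro h
    have hU : U.1 ⊆ W.1 := sections_le_iff.1 (h.1 (by simp))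
    have hV : V.1 ⊆ W.1 := sections_le_iff.1 (h.1 (by simp))
    -- The union is a section because it lies inside the section `W`.
    let T : P.sections := ⟨U.1 ∪ V.1, U.2.1.union V.2.1, U.2.2.1.union V.2.2.1,
      W.2.2.2.mono (Set.union_subset hU hV)⟩
    have hT : IsLUB {U, V} T := sections_isLUB T (by simp [T])
    exact congrArg Subtype.val (h.unique hT)
  · intro h
    exact sections_isLUB W (by simp [h])

variable (P) in
theorem fcc_sections : fcc P.sections := by
  intro S hS hc
  refine ⟨⟨⋃ U ∈ S, U.1, hS.isCompact_biUnion fun U _ => U.2.1,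
    isOpen_biUnion fun U _ => U.2.2.1, ?_⟩, sections_isLUB _ rfl⟩
  intro x hx y hy e
  obtain ⟨U, hU, hx⟩ := Set.mem_iUnion₂.1 hx
  obtain ⟨V, hV, hy⟩ := Set.mem_iUnion₂.1 hy
  by_cases h : U = V
  · subst h
    exact U.2.2.2 hx hy e
  · exact sections_compat_iff.1 (hc hU hV h) x hx y hy e

end

/-- The homomorphism between algebras of sections induced by a morphism. -/
def Hom.sectionsMap {P Q : HausEt.{u}} (φ : Hom P Q) : DRA.Hom Q.sections P.sections where
  toFun U := ⟨φ.toPFun.preimage U.1, φ.proper _ U.2.1, φ.continuous _ U.2.2.1, by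
    rintro x ⟨y, hy, hxy⟩ x' ⟨y', hy', hxy'⟩ e
    have := U.2.2.2 hy hy' (φ.preserves _ _ _ _ hxy hxy' e)
    subst this
    exact φ.fibre_injective _ _ _ hxy hxy' e⟩
  map_diff U V := Subtype.ext (PFun.preimage_diff _ _ _)
  map_rest U V := by
    refine Subtype.ext (Set.ext fun x => ⟨?_, ?_⟩)
    · rintro ⟨y, ⟨⟨y', hy', e⟩, hy⟩, hxy⟩
      -- Fibrewise surjectivity lifts the point of `U` over `y` to the fibre of `x`; the other
      -- inclusion needs only that fibres are preserved.
      obtain ⟨x', e', hx'⟩ := φ.fibre_surjective _ _ _ hxy e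
      exact ⟨⟨x', ⟨y', hy', hx'⟩, e'⟩, y, hy, hxy⟩
    · rintro ⟨⟨x', ⟨y', hy', hx'⟩, e⟩, y, hy, hxy⟩
      exact ⟨y, ⟨⟨y', hy', φ.preserves _ _ _ _ hx' hxy e⟩, hy⟩, hxy⟩

end HausEt

/-- The functor taking an étale space to its algebra of compact open sections. -/
def sectionsFunctor : HausEt.{u}ᵒᵖ ⥤ DRA.{u} where
  obj P := P.unop.sections
  map φ := HausEt.Hom.sectionsMap φ.unop
  map_id P := DRA.Hom.ext (funext fun U => Subtype.ext (by
    ext x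
    exact ⟨fun ⟨y, hy, h⟩ => Part.mem_some_iff.1 h ▸ hy, fun h => ⟨x, h, Part.mem_some x⟩⟩))
  map_comp φ ψ := DRA.Hom.ext (funext fun U => Subtype.ext (PFun.preimage_comp _ _ _))

/-! ### The unit -/

namespace DRA

/-- Primality for finite joins. The induction subtracts the members of `S` one by one from `j`, so
it never needs the join of a subfamily. -/
theorem isLUB_mem_iff {A : DRA.{u}} {S : Set A} (hS : S.Finite) {j : A} (hj : IsLUB S j)
    (μ : MaxFilter A) : j ∈ μ.1 ↔ ∃ a ∈ S, a ∈ μ.1 := by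
  refine ⟨fun h => ?_, fun ⟨a, ha, h⟩ => MaxFilter.mem_of_le (hj.1 ha) h⟩
  by_contra! hn
  obtain ⟨d, hd, hdS⟩ : ∃ d ∈ μ.1, ∀ a ∈ S, A.meet a d = A.bot := by
    clear hj
    induction S, hS using Set.Finite.induction_on with
    | empty => exact ⟨j, h, by simp⟩
    | @insert a T _ _ ih =>
      obtain ⟨d, hd, hdT⟩ := ih fun b hb => hn b (Set.mem_insert_of_mem _ hb)
      refine ⟨A.diff d a, MaxFilter.diff_mem_iff.2 ⟨hd, hn a (Set.mem_insert _ _)⟩, ?_⟩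
      rintro b (rfl | hb)
      · refine le_antisymm ?_ (bot_le _)
        rw [← meet_diff_self d b]
        exact le_meet (meet_le_right _ _) (meet_le_left _ _)
      · refine le_antisymm ?_ (bot_le _)
        rw [← hdT b hb]
        exact le_meet (meet_le_left _ _) ((meet_le_right _ _).trans (diff_le _ _))
  have : j ≤ A.diff j d := hj.2 fun a ha => le_diff (hj.1 ha) (hdS a ha)
  exact MaxFilter.notMem_of_diff_mem (MaxFilter.mem_of_le this h) hd

/-- The homomorphism from an algebra to the algebra of sections of its spectrum. -/
def toSections (A : DRA.{u}) : Hom A A.spectrum.sections where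
  toFun a := ⟨MaxFilter.basicOpen a, MaxFilter.isCompact_basicOpen a,
    MaxFilter.isOpen_basicOpen a, MaxFilter.injOn_toQuotient a⟩
  map_diff a b := Subtype.ext (MaxFilter.basicOpen_diff a b)
  map_rest a b := by
    refine Subtype.ext (Set.ext fun μ => MaxFilter.rest_mem_iff.trans ⟨?_, ?_⟩)
    · rintro ⟨hb, ξ, ha, h⟩
      exact ⟨⟨ξ, ha, MaxFilter.toQuotient_eq_iff.2 h.symm⟩, hb⟩
    · rintro ⟨⟨ξ, ha, h⟩, hb⟩
      exact ⟨hb, ξ, ha, (MaxFilter.toQuotient_eq_iff.1 h).symm⟩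

theorem toSections_injective (A : DRA.{u}) : Function.Injective A.toSections.toFun :=
  fun _ _ h => MaxFilter.basicOpen_injective (congrArg Subtype.val h)

/-- Compactness writes `U` as a finite union of sets `â`, and injectivity of the projection on `U`
makes these elements pairwise compatible. Their join `j` has basic set `U` by `isLUB_mem_iff`. -/
theorem toSections_surjective {A : DRA.{u}} (hA : fcc A) :
    Function.Surjective A.toSections.toFun := by
  intro U
  obtain ⟨S, hS, hU⟩ := (MaxFilter.isCompact_and_isOpen_iff U.1).1 ⟨U.2.1, U.2.2.1⟩
  have hmem : ∀ μ : MaxFilter A, μ ∈ U.1 ↔ ∃ a ∈ S, a ∈ μ.1 := fun μ => by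
    rw [hU]
    exact Set.mem_iUnion₂.trans (by simp)
  obtain ⟨j, hj⟩ := hA S hS (by
    have key : ∀ a ∈ S, ∀ b ∈ S, ∀ μ : MaxFilter A, A.rest a b ∈ μ.1 → A.rest b a ∈ μ.1 := by
      intro a ha b hb μ h
      obtain ⟨hbμ, ξ, haξ, e⟩ := MaxFilter.rest_mem_iff.1 h
      have : μ = ξ := U.2.2.2 ((hmem μ).2 ⟨b, hb, hbμ⟩) ((hmem ξ).2 ⟨a, ha, haξ⟩)
        (MaxFilter.toQuotient_eq_iff.2 e)
      exact MaxFilter.rest_mem_iff.2 ⟨this ▸ haξ, μ, hbμ, .refl μ⟩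
    exact fun a ha b hb _ => MaxFilter.eq_of_forall_mem_iff fun μ =>
      ⟨key a ha b hb μ, key b hb a ha μ⟩)
  exact ⟨j, Subtype.ext (Set.ext fun μ => (isLUB_mem_iff hS hj μ).trans (hmem μ).symm)⟩

/-- A bijective homomorphism is an isomorphism. -/
noncomputable def isoOfBijective {A B : DRA.{u}} (h : A ⟶ B) (hb : Function.Bijective h.toFun) :
    A ≅ B where
  hom := h
  inv :=
    { toFun := (Equiv.ofBijective _ hb).symm
      map_diff := fun a b => hb.1 (by
        rw [h.map_diff]; simp only [← Equiv.ofBijective_apply h.toFun, hb, Equiv.apply_symm_apply])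
      map_rest := fun a b => hb.1 (by
        rw [h.map_rest]; simp only [← Equiv.ofBijective_apply h.toFun, hb, Equiv.apply_symm_apply]) }
  hom_inv_id := Hom.ext (funext fun a => (Equiv.ofBijective _ hb).symm_apply_apply a)
  inv_hom_id := Hom.ext (funext fun a => (Equiv.ofBijective _ hb).apply_symm_apply a)

end DRA

/-! ### The counit -/

namespace HausEt

/-- A homeomorphism of total spaces that matches the fibres induces a morphism. -/
def ofHomeomorph {P Q : HausEt.{u}} (e : P.X ≃ₜ Q.X)
    (he : ∀ x y, P.proj x = P.proj y ↔ Q.proj (e x) = Q.proj (e y)) : P ⟶ Q where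
  toPFun := fun x => Part.some (e x)
  continuous := by
    intro V hV
    rw [PFun.preimage_some]
    exact hV.preimage e.continuous
  proper := by
    intro V hV
    rw [PFun.preimage_some]
    exact e.isCompact_preimage.2 hV
  preserves := by
    intro x x' y y' hy hy' h
    rw [Part.mem_some_iff.1 hy, Part.mem_some_iff.1 hy']
    exact (he _ _).1 h
  fibre_injective := by
    intro x x' y hy hy' h
    exact e.injective ((Part.mem_some_iff.1 hy).symm.trans (Part.mem_some_iff.1 hy'))
  fibre_surjective := by
    intro x y y' hy h
    rw [Part.mem_some_iff.1 hy] at h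
    refine ⟨e.symm y', (he _ _).2 ?_, ?_⟩
    · rwa [e.apply_symm_apply]
    · rw [e.apply_symm_apply]
      exact Part.mem_some y'

theorem mem_ofHomeomorph {P Q : HausEt.{u}} {e : P.X ≃ₜ Q.X}
    {he : ∀ x y, P.proj x = P.proj y ↔ Q.proj (e x) = Q.proj (e y)} {x : P.X} {y : Q.X} :
    y ∈ (ofHomeomorph e he).toPFun x ↔ y = e x := Part.mem_some_iff

/-- A homeomorphism of total spaces that matches the fibres induces an isomorphism. -/
def isoOfHomeomorph {P Q : HausEt.{u}} (e : P.X ≃ₜ Q.X)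
    (he : ∀ x y, P.proj x = P.proj y ↔ Q.proj (e x) = Q.proj (e y)) : P ≅ Q where
  hom := ofHomeomorph e he
  inv := ofHomeomorph e.symm fun x y => by rw [he, e.apply_symm_apply, e.apply_symm_apply]
  hom_inv_id := Hom.ext (PFun.ext fun x y => by
    refine Part.mem_bind_iff.trans (Iff.trans ?_ (Part.mem_some_iff).symm)
    simp [mem_ofHomeomorph])
  inv_hom_id := Hom.ext (PFun.ext fun x y => by
    refine Part.mem_bind_iff.trans (Iff.trans ?_ (Part.mem_some_iff).symm)
    simp [mem_ofHomeomorph])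

theorem mem_isoOfHomeomorph_hom {P Q : HausEt.{u}} {e : P.X ≃ₜ Q.X}
    {he : ∀ x y, P.proj x = P.proj y ↔ Q.proj (e x) = Q.proj (e y)} {x : P.X} {y : Q.X} :
    y ∈ (isoOfHomeomorph e he).hom.toPFun x ↔ y = e x := Part.mem_some_iff

theorem mem_isoOfHomeomorph_inv {P Q : HausEt.{u}} {e : P.X ≃ₜ Q.X}
    {he : ∀ x y, P.proj x = P.proj y ↔ Q.proj (e x) = Q.proj (e y)} {x : P.X} {y : Q.X} :
    x ∈ (isoOfHomeomorph e he).inv.toPFun y ↔ x = e.symm y := Part.mem_some_iff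

variable {P Q : HausEt.{u}}

/-- The compact open sections form a basis. -/
theorem exists_section (hP : lczd P) {U : Set P.X} (hU : IsOpen U) {x : P.X} (hx : x ∈ U) :
    ∃ V : P.sections, x ∈ V.1 ∧ V.1 ⊆ U := by
  have := hP.1
  obtain ⟨f, hf, hfP⟩ := P.localHomeo x
  obtain ⟨K, hK, hKU, hKc⟩ := local_compact_nhds ((hU.inter f.open_source).mem_nhds ⟨hx, hf⟩)
  obtain ⟨V, hV, hVK, hVc⟩ := hP.2 x K hK
  refine ⟨⟨V, hKc.of_isClosed_subset hVc.1 hVK, hVc.2, ?_⟩, mem_of_mem_nhds hV,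
    fun y hy => (hKU (hVK hy)).1⟩
  rw [hfP]
  exact f.injOn.mono fun y hy => (hKU (hVK hy)).2

/-- The maximal filter of sections through a point. -/
def ptFilter (hP : lczd P) (x : P.X) : MaxFilter P.sections :=
  ⟨{U | x ∈ U.1}, by
    rw [maximal_isPFilter_iff, isPFilter_iff]
    refine ⟨⟨?_, fun U V h hU => sections_le_iff.1 h hU, fun U hU V hV => ?_⟩, ?_,
      fun U hU V => ?_⟩
    · obtain ⟨U, hU, -⟩ := exists_section hP isOpen_univ (Set.mem_univ x)
      exact ⟨U, hU⟩
    · rw [Set.mem_ofPred_eq, sections_meet]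
      exact ⟨hU, hV⟩
    · rw [Set.mem_ofPred_eq, sections_bot]
      exact Set.notMem_empty x
    · exact (em (x ∈ V.1)).imp id fun h => ⟨hU, h⟩⟩

theorem mem_ptFilter {hP : lczd P} {x : P.X} {U : P.sections} :
    U ∈ (ptFilter hP x).1 ↔ x ∈ U.1 := Iff.rfl

theorem ptFilter_injective (hP : lczd P) : Function.Injective (ptFilter hP) := by
  intro x y h
  by_contra hne
  obtain ⟨V, hV, hVy⟩ := exists_section hP (isOpen_compl_singleton (x := y)) hne
  rw [← mem_ptFilter (hP := hP), h] at hV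
  exact hVy (mem_ptFilter.1 hV) rfl

/-- With `W ∈ μ` fixed, the sets `U ∩ W` for `U ∈ μ` form a directed family of nonempty compact
closed sets. A common point `x` gives `μ ⊆ ptFilter hP x`, and maximality gives equality. -/
theorem ptFilter_surjective (hP : lczd P) : Function.Surjective (ptFilter hP) := by
  intro μ
  obtain ⟨W, hW⟩ := μ.nonempty
  have : (⋂ U : μ.1, U.1.1 ∩ W.1).Nonempty := by
    have : Nonempty μ.1 := ⟨⟨W, hW⟩⟩
    refine IsCompact.nonempty_iInter_of_directed_nonempty_isCompact_isClosed _ ?_ ?_ ?_ ?_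
    · rintro ⟨U, hU⟩ ⟨V, hV⟩
      refine ⟨⟨_, MaxFilter.meet_mem hU hV⟩, ?_, ?_⟩
      · exact Set.inter_subset_inter_left _ (sections_le_iff.1 (DRA.meet_le_left U V))
      · exact Set.inter_subset_inter_left _ (sections_le_iff.1 (DRA.meet_le_right U V))
    · rintro ⟨U, hU⟩
      refine Set.nonempty_iff_ne_empty.2 fun h => μ.bot_notMem ?_
      have : P.sections.meet U W = P.sections.bot :=
        Subtype.ext ((sections_meet U W).trans (h.trans sections_bot.symm))
      exact this ▸ MaxFilter.meet_mem hU hW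
    · exact fun U => U.1.2.1.inter W.2.1
    · exact fun U => U.1.2.1.isClosed.inter W.2.1.isClosed
  obtain ⟨x, hx⟩ := this
  exact ⟨x, (MaxFilter.eq_of_subset fun U hU => (Set.mem_iInter.1 hx ⟨U, hU⟩).1).symm⟩

/-- The homeomorphism from a space to the space of maximal filters of its sections. -/
noncomputable def ptHomeomorph (hP : lczd P) : P.X ≃ₜ P.sections.spectrum.X :=
  Equiv.toHomeomorphOfContinuousOpen (Y := MaxFilter P.sections)
    (Equiv.ofBijective _ ⟨ptFilter_injective hP, ptFilter_surjective hP⟩)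
    (by
      rw [MaxFilter.isTopologicalBasis_basicOpen.continuous_iff]
      rintro _ ⟨U, rfl⟩
      exact U.2.2.1)
    (by
      intro U hU
      rw [isOpen_iff_forall_mem_open]
      rintro _ ⟨x, hx, rfl⟩
      obtain ⟨V, hV, hVU⟩ := exists_section hP hU hx
      refine ⟨MaxFilter.basicOpen V, fun μ hμ => ?_, MaxFilter.isOpen_basicOpen V, hV⟩
      obtain ⟨y, rfl⟩ := ptFilter_surjective hP μ
      exact ⟨y, hVU hμ, rfl⟩)

/-- Disjoint neighbourhoods in the base pull back to sections around `x` and `y` sharing no fibre,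
so restricting one by the other loses the point. -/
theorem equivalent_ptFilter_iff (hP : lczd P) (x y : P.X) :
    (ptFilter hP x).Equivalent (ptFilter hP y) ↔ P.proj x = P.proj y := by
  constructor
  · intro h
    by_contra hne
    obtain ⟨U, V, hU, hV, hxU, hyV, hUV⟩ := t2_separation hne
    obtain ⟨U', hxU', hU'⟩ := exists_section hP (hU.preimage P.localHomeo.continuous) hxU
    obtain ⟨V', hyV', hV'⟩ := exists_section hP (hV.preimage P.localHomeo.continuous) hyV
    obtain ⟨⟨z, hz, e⟩, -⟩ := h.1 U' hxU' V' hyV'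
    exact Set.disjoint_left.1 hUV (e ▸ hU' hz) hyV
  · exact fun e => ⟨fun U hU V hV => ⟨⟨x, hU, e⟩, hV⟩, fun V hV U hU => ⟨⟨y, hV, e.symm⟩, hU⟩⟩

theorem ptHomeomorph_fibres (hP : lczd P) (x y : P.X) : P.proj x = P.proj y ↔
    P.sections.spectrum.proj (ptHomeomorph hP x) = P.sections.spectrum.proj (ptHomeomorph hP y) :=
  (equivalent_ptFilter_iff hP x y).symm.trans MaxFilter.toQuotient_eq_iff.symm

/-- The isomorphism between a space and the spectrum of its algebra of sections. -/
noncomputable def ptIso (hP : lczd P) : P ≅ P.sections.spectrum :=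
  isoOfHomeomorph (ptHomeomorph hP) (ptHomeomorph_fibres hP)

theorem mem_ptIso_hom {hP : lczd P} {x : P.X} {μ : P.sections.spectrum.X} :
    μ ∈ (ptIso hP).hom.toPFun x ↔ μ = ptFilter hP x := Part.mem_some_iff

/-- The inverse image of the filter at `x` is the filter at `φ x`. The domains agree because a
section in the inverse image contains a value of `φ` at `x`. -/
theorem ptIso_naturality (hP : lczd P) (hQ : lczd Q) (φ : P ⟶ Q) :
    φ ≫ (ptIso hQ).hom = (ptIso hP).hom ≫ DRA.Hom.spectrumMap (Hom.sectionsMap φ) := by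
  refine Hom.ext (PFun.ext fun x ν => ?_)
  refine Part.mem_bind_iff.trans (Iff.trans ?_ Part.mem_bind_iff.symm)
  have key : ∀ y ∈ φ.toPFun x, ptFilter hQ y ∈ (Hom.sectionsMap φ).comap (ptFilter hP x) := by
    intro y hy
    refine (DRA.Hom.mem_comap _).2 (Set.ext fun U => ⟨fun h => ⟨y, h, hy⟩, ?_⟩)
    rintro ⟨z, hz, hxz⟩
    exact Part.mem_unique hy hxz ▸ hz
  constructor
  · rintro ⟨y, hy, hν⟩
    rw [mem_ptIso_hom.1 hν]
    exact ⟨_, mem_ptIso_hom.2 rfl, key y hy⟩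
  · rintro ⟨μ, hμ, hν⟩
    rw [mem_ptIso_hom.1 hμ] at hν
    obtain ⟨U, hU⟩ := ν.nonempty
    obtain ⟨y, -, hy⟩ := (DRA.Hom.mem_of_mem_comap _ hν).1 hU
    exact ⟨y, hy, mem_ptIso_hom.2 (Part.mem_unique hν (key y hy))⟩

end HausEt

/-! ### Operators on the spectrum -/

namespace DRA

variable {A : DRA.{u}} {n : ℕ} {f : (Fin n → A) → A}

/-- If `a i ≤ b i`, then `b i` is the join of the two, so additivity allows coordinates to be raised
one at a time. -/
theorem Additive.mono (hf : A.Additive f) {a b : Fin n → A} (hab : ∀ i, a i ≤ b i) :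
    f a ≤ f b := by
  classical
  have key : ∀ s : Finset (Fin n), f a ≤ f (s.piecewise b a) := by
    intro s
    induction s using Finset.induction_on with
    | empty => rw [Finset.piecewise_empty]
    | insert i s hi ih =>
      refine ih.trans ?_
      have h : IsLUB {a i, b i} (b i) := by
        constructor
        · rintro c (rfl | rfl)
          exacts [hab i, le_rfl]
        · exact fun c hc => hc (by simp)
      have h1 := (hf (s.piecewise b a) i _ _ _ h).1 (Set.mem_insert _ _)
      rwa [← Finset.piecewise_insert, ← Finset.piecewise_eq_of_notMem s b a hi,
        Function.update_eq_self] at h1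
  simpa using key Finset.univ

end DRA

namespace MaxFilter

variable {A : DRA.{u}} {n : ℕ} {f : (Fin n → A) → A}

/-- Filters whose image under an operator lies in a maximal filter extend to maximal filters with
the same property. -/
theorem exists_opRel (hf : A.IsOperator f) {F : Fin n → Set A} (hF : ∀ i, Order.IsPFilter (F i))
    {ν : MaxFilter A} (hν : ∀ a : Fin n → A, (∀ i, a i ∈ F i) → f a ∈ ν.1) :
    ∃ μ : Fin n → MaxFilter A, (∀ i, F i ⊆ (μ i).1) ∧ opRel f μ ν := by
  classical
  obtain ⟨hbot, hadd⟩ := hf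
  -- The coordinates in `s` have been made maximal, while `f` still maps the product of the filters
  -- into `ν`.
  have key : ∀ s : Finset (Fin n), ∃ G : Fin n → Set A, (∀ i, Order.IsPFilter (G i)) ∧
      (∀ i, F i ⊆ G i) ∧ (∀ i ∈ s, ∃ μ : MaxFilter A, μ.1 = G i) ∧
      ∀ a : Fin n → A, (∀ i, a i ∈ G i) → f a ∈ ν.1 := by
    intro s
    induction s using Finset.induction_on with
    | empty => exact ⟨F, hF, fun _ => subset_rfl, by simp, hν⟩
    | insert i s hi ih =>
      obtain ⟨G, hG, hFG, hGs, hGν⟩ := ih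
      -- The ideal consists of the forbidden `b`: those that some choice of the other coordinates
      -- sends outside `ν`. It contains `0` by normality, is a down-set by monotonicity, and is
      -- closed under joins by additivity and primality of `ν`.
      obtain ⟨μ, hμ, hμI⟩ := exists_maxFilter (hG i)
        (I := {b : A | ∃ a : Fin n → A, (∀ j, a j ∈ G j) ∧ f (Function.update a i b) ∉ ν.1})
        (by
          choose a ha using fun j => (isPFilter_iff.1 (hG j)).1
          refine ⟨a, ha, fun h => ν.bot_notMem ?_⟩
          have hb : IsBot (f (Function.update a i A.bot)) :=
            hbot _ i (by rw [Function.update_self]; exact DRA.bot_le)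
          rwa [DRA.isBot_iff.1 hb] at h)
        (by
          rintro b c hbc ⟨a, ha, hc⟩
          refine ⟨a, ha, fun hb => hc (mem_of_le (hadd.mono fun j => ?_) hb)⟩
          obtain rfl | hj := eq_or_ne j i
          · simpa using hbc
          · simp [hj])
        (by
          rintro b c d hd ⟨a, ha, hb⟩ ⟨a', ha', hc⟩
          refine ⟨fun j => A.meet (a j) (a' j),
            fun j => (isPFilter_iff.1 (hG j)).2.2 _ (ha j) _ (ha' j), fun h => ?_⟩
          obtain h | h := mem_or_mem_of_isLUB (hadd _ i _ _ _ hd) h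
          · refine hb (mem_of_le (hadd.mono fun j => ?_) h)
            obtain rfl | hj := eq_or_ne j i
            · simp
            · simpa [hj] using DRA.meet_le_left _ _
          · refine hc (mem_of_le (hadd.mono fun j => ?_) h)
            obtain rfl | hj := eq_or_ne j i
            · simp
            · simpa [hj] using DRA.meet_le_right _ _)
        (by
          rw [Set.disjoint_left]
          rintro b hb ⟨a, ha, hn⟩
          refine hn (hGν _ fun j => ?_)
          obtain rfl | hj := eq_or_ne j i
          · simpa using hb
          · simpa [hj] using ha j)
      refine ⟨Function.update G i μ.1, fun j => ?_, fun j => ?_, fun j hj => ?_, fun a ha => ?_⟩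
      · obtain rfl | hj := eq_or_ne j i
        · simpa using μ.isPFilter
        · simpa [hj] using hG j
      · obtain rfl | hj := eq_or_ne j i
        · simpa using (hFG j).trans hμ
        · simpa [hj] using hFG j
      · obtain rfl | hji := eq_or_ne j i
        · exact ⟨μ, by simp⟩
        · simpa [hji] using hGs j (Finset.mem_of_mem_insert_of_ne hj hji)
      · by_contra hn
        obtain ⟨g, hg⟩ := (isPFilter_iff.1 (hG i)).1
        refine Set.disjoint_left.1 hμI (by simpa using ha i : a i ∈ μ.1)
          ⟨Function.update a i g, fun j => ?_, by simpa using hn⟩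
        obtain rfl | hj := eq_or_ne j i
        · simpa using hg
        · simpa [hj] using ha j
  obtain ⟨G, -, hFG, hG, hGν⟩ := key Finset.univ
  choose μ hμ using fun i => hG i (Finset.mem_univ i)
  exact ⟨μ, fun i => (hFG i).trans_eq (hμ i).symm,
    fun a ha => hGν a fun i => hμ i ▸ ha i⟩

/-- The nontrivial inclusion extends the principal filters of the `a i`, whose values stay in `ν` by
monotonicity. -/
theorem relImage_opRel_basicOpen (hf : A.IsOperator f) (a : Fin n → A) :
    relImage (opRel f) (fun i => basicOpen (a i)) = basicOpen (f a) := by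
  ext ν
  constructor
  · rintro ⟨μ, hμ, h⟩
    exact h a hμ
  · intro h
    obtain ⟨μ, hμ, hR⟩ := exists_opRel hf (F := fun i => Set.Ici (a i))
      (fun i => isPFilter_Ici (a i)) fun b hb => mem_of_le (hf.2.mono hb) h
    exact ⟨μ, fun i => hμ i (Set.mem_Ici.2 le_rfl), hR⟩

theorem isTightRel_opRel : IsTightRel (opRel f) := fun μ ν h a ha => by
  obtain ⟨μ', hμ', hR⟩ := h (fun i => basicOpen (a i))
    (fun i => ⟨isCompact_basicOpen _, isOpen_basicOpen _⟩) ha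
  exact hR a hμ'

theorem isContinuousRel_opRel (hf : A.IsOperator f) : IsContinuousRel (opRel f) := by
  intro S hS
  rw [isOpen_iff_forall_mem_open]
  rintro ν ⟨μ, hμ, hR⟩
  choose a ha haS using fun i => exists_basicOpen_subset (hS i) (hμ i)
  refine ⟨relImage (opRel f) fun i => basicOpen (a i), ?_, ?_, μ, ha, hR⟩
  · rintro ν' ⟨μ', hμ', hR'⟩
    exact ⟨μ', fun i => haS i (hμ' i), hR'⟩
  · rw [relImage_opRel_basicOpen hf]
    exact isOpen_basicOpen _

/-- Compact open sets are finite unions of basic sets, and relational images distribute over unions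
in each argument. -/
theorem isSpectralRel_opRel (hf : A.IsOperator f) : IsSpectralRel (opRel f) := by
  refine ⟨isContinuousRel_opRel hf, fun S hS => ?_⟩
  refine ⟨?_, isContinuousRel_opRel hf S fun i => (hS i).2⟩
  choose T hT hST using fun i => (isCompact_and_isOpen_iff (S i)).1 (hS i)
  have : relImage (opRel f) S = ⋃ a ∈ Set.pi Set.univ T, basicOpen (f a) := by
    ext ν
    simp only [← relImage_opRel_basicOpen hf, Set.mem_iUnion]
    constructor
    · rintro ⟨μ, hμ, hR⟩
      choose a ha haμ using fun i => Set.mem_iUnion₂.1 (hST i ▸ hμ i)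
      exact ⟨a, fun i _ => ha i, μ, haμ, hR⟩
    · rintro ⟨a, ha, μ, hμ, hR⟩
      refine ⟨μ, fun i => ?_, hR⟩
      rw [hST i]
      exact Set.mem_iUnion₂.2 ⟨a i, ha i trivial, hμ i⟩
  rw [this]
  exact (Set.Finite.pi hT).isCompact_biUnion
    fun a _ => isCompact_basicOpen _

/-- In each coordinate the two filters are either equal, and share an element, or inequivalent, and
contain elements with disjoint domains. Either way compatible representatives exist. -/
theorem compatProperty_opRel (hf : A.CompatPreserving f) :
    A.spectrum.CompatProperty (opRel f) := by
  intro μ μ' ν ν' h hR hR' e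
  have : ∀ i, ∃ a ∈ (μ i).1, ∃ b ∈ (μ' i).1, A.Compat a b := by
    intro i
    by_cases hi : Equivalent (μ i) (μ' i)
    · obtain ⟨a, ha⟩ := (μ i).nonempty
      have : μ i = μ' i := h i (toQuotient_eq_iff.2 hi)
      exact ⟨a, ha, a, this ▸ ha, rfl⟩
    · obtain ⟨a, ha, b, hb, hab⟩ := exists_rest_eq_bot hi
      exact ⟨a, ha, b, hb, hab.trans (DRA.rest_eq_bot_symm hab).symm⟩
  choose a ha b hb hab using this
  replace e := toQuotient_eq_iff.1 e
  -- Compatibility puts `f a ▹ f b` below `f a`, so `f a` is common to the equivalent filters `ν`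
  -- and `ν'`.
  refine e.eq (hR a ha) (mem_of_le (hf a b hab).rest_le (e.1 _ (hR a ha) _ (hR' b hb)))

end MaxFilter

/-! ### The spectrum functor in the presence of operators. -/

variable {σ : OpSignature.{v}}

/-- The étale space of maximal filters of an algebra with operators. -/
def DRAOp.spectrum (A : DRAOp.{u} σ) : HausEtOp.{u} σ where
  space := A.alg.spectrum
  rel s := MaxFilter.opRel (A.op s)
  tight _ := MaxFilter.isTightRel_opRel
  spectral s := MaxFilter.isSpectralRel_opRel (A.operator s)
  compat s := MaxFilter.compatProperty_opRel (A.compat s)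

/-- The functor taking an algebra with operators to its étale space of maximal filters. -/
noncomputable def spectrumFunctorOp (σ : OpSignature.{v}) : (DRAOp.{u} σ)ᵒᵖ ⥤ HausEtOp.{u} σ where
  obj A := A.unop.spectrum
  map {A B} h :=
    { base := DRA.Hom.spectrumMap h.unop.base
      forth := by
        intro s ξ ξ' μ hR hμ
        have key : ∀ a, (∀ i, a i ∈ (μ i).1) →
            h.unop.base.toFun (B.unop.op s a) ∈ ξ'.1 := by
          intro a ha
          rw [h.unop.map_op]
          exact hR _ fun i => (DRA.Hom.mem_of_mem_comap _ (hμ i)).1 (ha i)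
        choose a ha using fun i => (μ i).nonempty
        obtain ⟨μ', hμ', -⟩ := DRA.Hom.exists_mem_comap _ (key a ha)
        exact ⟨μ', hμ', fun b hb => (DRA.Hom.mem_of_mem_comap _ hμ').2 (key b hb)⟩
      back := by
        intro s ξ' μ μ' hμ' hR
        -- The filters generated by the images of the `μ i` are sent into `ξ'` by the operator, so
        -- they extend to related maximal filters. The inverse images of these contain the `μ i`,
        -- hence equal them.
        obtain ⟨ξ, hξ, hRξ⟩ := MaxFilter.exists_opRel (A.unop.operator s) (ν := ξ')
          (F := fun i => {b | ∃ a ∈ (μ i).1, h.unop.base.toFun a ≤ b}) (by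
            intro i
            obtain ⟨a, ha⟩ := (μ i).nonempty
            refine isPFilter_iff.2 ⟨⟨_, a, ha, le_rfl⟩,
              fun b c hbc ⟨a, ha, hab⟩ => ⟨a, ha, hab.trans hbc⟩, ?_⟩
            rintro b ⟨a, ha, hab⟩ c ⟨a', ha', hac⟩
            refine ⟨_, MaxFilter.meet_mem ha ha', ?_⟩
            rw [DRA.Hom.map_meet]
            exact DRA.le_meet ((DRA.meet_le_left _ _).trans hab)
              ((DRA.meet_le_right _ _).trans hac))
          (by
            intro b hb
            choose a ha hab using hb
            refine MaxFilter.mem_of_le ((A.unop.operator s).2.mono hab) ?_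
            rw [← h.unop.map_op, ← DRA.Hom.mem_of_mem_comap _ hμ']
            exact hR a ha)
        refine ⟨ξ, fun i => ?_, hRξ⟩
        obtain ⟨a, ha⟩ := (μ i).nonempty
        obtain ⟨ρ, hρ, -⟩ := DRA.Hom.exists_mem_comap h.unop.base (hξ i ⟨a, ha, le_rfl⟩)
        have : μ i = ρ := MaxFilter.eq_of_subset fun b hb =>
          (DRA.Hom.mem_of_mem_comap _ hρ).2 (hξ i ⟨b, hb, le_rfl⟩)
        exact this ▸ hρ }
  map_id A := HausEtOp.Hom.ext (spectrumFunctor.map_id (op A.unop.alg))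
  map_comp f g := HausEtOp.Hom.ext (spectrumFunctor.map_comp f.unop.base.op g.unop.base.op)

/-! ### Relations and sections -/

namespace HausEt

variable {P : HausEt.{u}} {n : ℕ} {R : (Fin n → P.X) → P.X → Prop}

/-- The operation on sections induced by a relation. -/
def sectionsOp (hR : IsSpectralRel R) (hc : P.CompatProperty R) (U : Fin n → P.sections) :
    P.sections :=
  have h := hR.2 (fun i => (U i).1) fun i => ⟨(U i).2.1, (U i).2.2.1⟩
  ⟨relImage R fun i => (U i).1, h.1, h.2, by
    rintro y ⟨x, hx, hy⟩ y' ⟨x', hx', hy'⟩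
    -- Two points of one section are compatible, so the compatibility property makes the image a
    -- section.
    exact hc x x' y y' (fun i => (U i).2.2.2 (hx i) (hx' i)) hy hy'⟩

theorem compatPreserving_sectionsOp (hR : IsSpectralRel R) (hc : P.CompatProperty R) :
    P.sections.CompatPreserving (sectionsOp hR hc) := by
  intro U U' h
  rw [sections_compat_iff]
  rintro y ⟨x, hx, hy⟩ y' ⟨x', hx', hy'⟩
  exact hc x x' y y' (fun i => sections_compat_iff.1 (h i) _ (hx i) _ (hx' i)) hy hy'

theorem isOperator_sectionsOp (hR : IsSpectralRel R) (hc : P.CompatProperty R) :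
    P.sections.IsOperator (sectionsOp hR hc) := by
  constructor
  · intro U i h
    rw [sections_isBot_iff] at h ⊢
    refine Set.eq_empty_of_forall_notMem ?_
    rintro y ⟨x, hx, -⟩
    have : x i ∈ (∅ : Set P.X) := h ▸ hx i
    exact this
  · intro U i V W T h
    rw [sections_isLUB_pair_iff] at h ⊢
    ext y
    have aux : ∀ (Z : P.sections) (x : Fin n → P.X),
        (∀ j, x j ∈ (Function.update U i Z j).1) ↔ x i ∈ Z.1 ∧ ∀ j ≠ i, x j ∈ (U j).1 := by
      intro Z x
      constructor
      · intro hx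
        exact ⟨by simpa using hx i, fun j hj => by simpa [hj] using hx j⟩
      · rintro ⟨h1, h2⟩ j
        obtain rfl | hj := eq_or_ne j i
        · simpa using h1
        · simpa [hj] using h2 j hj
    have mem : ∀ Z : P.sections, y ∈ (sectionsOp hR hc (Function.update U i Z)).1 ↔
        ∃ x, (x i ∈ Z.1 ∧ ∀ j ≠ i, x j ∈ (U j).1) ∧ R x y :=
      fun Z => exists_congr fun x => and_congr_left fun _ => aux Z x
    rw [Set.mem_union, mem, mem, mem, h, ← exists_or]
    refine exists_congr fun x => ?_
    rw [Set.mem_union]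
    tauto

end HausEt

/-- The compact open sections of an étale space with relations. -/
def HausEtOp.sections (P : HausEtOp.{u} σ) : DRAOp.{u} σ where
  alg := P.space.sections
  op s := HausEt.sectionsOp (P.spectral s) (P.compat s)
  compat s := HausEt.compatPreserving_sectionsOp (P.spectral s) (P.compat s)
  operator s := HausEt.isOperator_sectionsOp (P.spectral s) (P.compat s)

/-- The functor taking an étale space with relations to its algebra of compact open sections. -/
def sectionsFunctorOp (σ : OpSignature.{v}) : (HausEtOp.{u} σ)ᵒᵖ ⥤ DRAOp.{u} σ where
  obj P := P.unop.sections
  map φ :=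
    { base := HausEt.Hom.sectionsMap φ.unop.base
      map_op := by
        intro s U
        refine Subtype.ext (Set.ext fun x' => ⟨?_, ?_⟩)
        -- The back condition gives this inclusion, the forth condition the other.
        · rintro ⟨y', ⟨y, hy, hR⟩, hx'⟩
          obtain ⟨x, hx, hR'⟩ := φ.unop.back s x' y y' hx' hR
          exact ⟨x, fun i => ⟨y i, hy i, hx i⟩, hR'⟩
        · rintro ⟨x, hx, hR⟩
          choose y hy hxy using hx
          obtain ⟨y', hy', hR'⟩ := φ.unop.forth s x x' y hR hxy
          exact ⟨y', ⟨y, hy, hR'⟩, hy'⟩ }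
  map_id P := DRAOp.Hom.ext (sectionsFunctor.map_id (op P.unop.space))
  map_comp f g := DRAOp.Hom.ext (sectionsFunctor.map_comp f.unop.base.op g.unop.base.op)

/-! ### Isomorphisms compatible with operators and relations. -/

/-- An isomorphism of algebras that preserves the operators. -/
def DRAOp.isoMk {A B : DRAOp.{u} σ} (e : A.alg ≅ B.alg)
    (h : ∀ s a, e.hom.toFun (A.op s a) = B.op s fun i => e.hom.toFun (a i)) : A ≅ B where
  hom := ⟨e.hom, h⟩
  inv := ⟨e.inv, fun s a => by
    have h1 : ∀ b, e.hom.toFun (e.inv.toFun b) = b :=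
      fun b => congrFun (congrArg DRA.Hom.toFun e.inv_hom_id) b
    have h2 : ∀ b, e.inv.toFun (e.hom.toFun b) = b :=
      fun b => congrFun (congrArg DRA.Hom.toFun e.hom_inv_id) b
    have h3 := h s fun i => e.inv.toFun (a i)
    simp only [h1] at h3
    rw [← h3, h2]⟩
  hom_inv_id := Hom.ext e.hom_inv_id
  inv_hom_id := Hom.ext e.inv_hom_id

/-- A homeomorphism of total spaces that matches the fibres and the relations induces an
isomorphism. -/
def HausEtOp.isoOfHomeomorph {P Q : HausEtOp.{u} σ} (e : P.space.X ≃ₜ Q.space.X)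
    (he : ∀ x y, P.space.proj x = P.space.proj y ↔ Q.space.proj (e x) = Q.space.proj (e y))
    (hr : ∀ s x y, P.rel s x y ↔ Q.rel s (fun i => e (x i)) (e y)) : P ≅ Q where
  hom :=
    { base := (HausEt.isoOfHomeomorph e he).hom
      forth := by
        intro s x x' y hR hy
        have : y = fun i => e (x i) := funext fun i => HausEt.mem_isoOfHomeomorph_hom.1 (hy i)
        exact ⟨e x', HausEt.mem_isoOfHomeomorph_hom.2 rfl, this ▸ (hr s x x').1 hR⟩
      back := by
        intro s x' y y' hy hR
        rw [HausEt.mem_isoOfHomeomorph_hom.1 hy] at hR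
        refine ⟨fun i => e.symm (y i), fun i => HausEt.mem_isoOfHomeomorph_hom.2 (by simp), ?_⟩
        rw [hr]
        simpa using hR }
  inv :=
    { base := (HausEt.isoOfHomeomorph e he).inv
      forth := by
        intro s y y' x hR hx
        have : y = fun i => e (x i) := funext fun i => by
          rw [HausEt.mem_isoOfHomeomorph_inv.1 (hx i), e.apply_symm_apply]
        refine ⟨e.symm y', HausEt.mem_isoOfHomeomorph_inv.2 rfl, ?_⟩
        rw [hr, e.apply_symm_apply]
        exact this ▸ hR
      back := by
        intro s y' x x' hx hR
        rw [HausEt.mem_isoOfHomeomorph_inv.1 hx, hr, e.apply_symm_apply] at hR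
        exact ⟨fun i => e (x i), fun i => HausEt.mem_isoOfHomeomorph_inv.2 (by simp), hR⟩ }
  hom_inv_id := Hom.ext (HausEt.isoOfHomeomorph e he).hom_inv_id
  inv_hom_id := Hom.ext (HausEt.isoOfHomeomorph e he).inv_hom_id

/-- The backward direction is tightness, which may be tested on sections because these form a basis.
-/
theorem HausEt.opRel_ptFilter_iff {P : HausEt.{u}} (hP : lczd P) {n : ℕ}
    {R : (Fin n → P.X) → P.X → Prop} (ht : IsTightRel R) (hR : IsSpectralRel R)
    (hc : P.CompatProperty R) (x : Fin n → P.X) (y : P.X) :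
    R x y ↔ MaxFilter.opRel (sectionsOp hR hc) (fun i => ptFilter hP (x i)) (ptFilter hP y) := by
  constructor
  · exact fun h U hU => ⟨x, hU, h⟩
  · intro h
    refine ht x y fun S hS hx => ?_
    choose U hU hUS using fun i => exists_section hP (hS i).2 (hx i)
    obtain ⟨x', hx', hR'⟩ := h U hU
    exact ⟨x', fun i => hUS i (hx' i), hR'⟩

/-! ### The equivalences -/

/-- The spectrum functor on finitarily compatibly complete algebras. -/
noncomputable def stoneFunctor : CfinDRA.{u} ⥤ StoneEt.{u}ᵒᵖ :=
  (lczd.lift (fcc.ι.op ⋙ spectrumFunctor) fun A => A.unop.obj.lczd_spectrum).rightOp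

/-- The sections functor on locally compact zero-dimensional étale spaces. -/
def costoneFunctor : StoneEt.{u}ᵒᵖ ⥤ CfinDRA.{u} :=
  fcc.lift (lczd.ι.op ⋙ sectionsFunctor) fun P => HausEt.fcc_sections P.unop.obj

/-- An algebra is naturally isomorphic to the algebra of sections of its spectrum. -/
noncomputable def stoneUnit : 𝟭 CfinDRA.{u} ≅ stoneFunctor ⋙ costoneFunctor :=
  NatIso.ofComponents
    (fun A => fcc.isoMk (DRA.isoOfBijective A.obj.toSections
      ⟨A.obj.toSections_injective, DRA.toSections_surjective A.property⟩))
    (fun h => ObjectProperty.hom_ext _ (DRA.Hom.ext (funext fun a =>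
      Subtype.ext (DRA.Hom.preimage_comap_basicOpen h.hom a).symm)))

/-- A space is naturally isomorphic to the spectrum of its algebra of sections. -/
noncomputable def stoneCounit : costoneFunctor ⋙ stoneFunctor ≅ 𝟭 StoneEt.{u}ᵒᵖ :=
  NatIso.ofComponents
    (fun P => (lczd.isoMk (HausEt.ptIso P.unop.property)).op)
    (fun {P Q} φ => by exact Quiver.Hom.unop_inj (ObjectProperty.hom_ext _
      (HausEt.ptIso_naturality Q.unop.property P.unop.property φ.unop.hom).symm))

/-- The duality without operators. -/
noncomputable def stoneDuality : CfinDRA.{u} ≌ StoneEt.{u}ᵒᵖ :=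
  CategoryTheory.Equivalence.mk stoneFunctor costoneFunctor stoneUnit stoneCounit

section

variable (σ : OpSignature.{v})

/-- The spectrum functor on finitarily compatibly complete algebras with operators. -/
noncomputable def stoneFunctorOp : CfinDRAOp.{u} σ ⥤ (StoneEtOp.{u} σ)ᵒᵖ :=
  ((lczdOp σ).lift ((fccOp σ).ι.op ⋙ spectrumFunctorOp σ)
    fun A => A.unop.obj.alg.lczd_spectrum).rightOp

/-- The sections functor on locally compact zero-dimensional étale spaces with relations. -/
def costoneFunctorOp : (StoneEtOp.{u} σ)ᵒᵖ ⥤ CfinDRAOp.{u} σ :=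
  (fccOp σ).lift ((lczdOp σ).ι.op ⋙ sectionsFunctorOp σ)
    fun P => HausEt.fcc_sections P.unop.obj.space

/-- An algebra with operators is naturally isomorphic to the algebra of sections of its
spectrum. -/
noncomputable def stoneUnitOp :
    𝟭 (CfinDRAOp.{u} σ) ≅ stoneFunctorOp σ ⋙ costoneFunctorOp σ :=
  NatIso.ofComponents
    (fun A => (fccOp σ).isoMk (DRAOp.isoMk (DRA.isoOfBijective A.obj.alg.toSections
      ⟨A.obj.alg.toSections_injective, DRA.toSections_surjective A.property⟩)
      fun s a => Subtype.ext
        (MaxFilter.relImage_opRel_basicOpen (A.obj.operator s) a).symm))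
    (fun h => ObjectProperty.hom_ext _ (DRAOp.Hom.ext (DRA.Hom.ext (funext fun a =>
      Subtype.ext (DRA.Hom.preimage_comap_basicOpen h.hom.base a).symm))))

/-- A space with relations is naturally isomorphic to the spectrum of its algebra of sections. -/
noncomputable def stoneCounitOp :
    costoneFunctorOp σ ⋙ stoneFunctorOp σ ≅ 𝟭 (StoneEtOp.{u} σ)ᵒᵖ :=
  NatIso.ofComponents
    (fun P => ((lczdOp σ).isoMk (HausEtOp.isoOfHomeomorph (Q := P.unop.obj.sections.spectrum)
      (HausEt.ptHomeomorph P.unop.property) (HausEt.ptHomeomorph_fibres P.unop.property)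
      fun s => HausEt.opRel_ptFilter_iff P.unop.property (P.unop.obj.tight s)
        (P.unop.obj.spectral s) (P.unop.obj.compat s))).op)
    (fun {P Q} φ => by exact Quiver.Hom.unop_inj (ObjectProperty.hom_ext _ (HausEtOp.Hom.ext
      (HausEt.ptIso_naturality Q.unop.property P.unop.property φ.unop.hom.base).symm)))

/-- The duality with operators. -/
noncomputable def stoneDualityOp : CfinDRAOp.{u} σ ≌ (StoneEtOp.{u} σ)ᵒᵖ :=
  CategoryTheory.Equivalence.mk (stoneFunctorOp σ) (costoneFunctorOp σ) (stoneUnitOp σ)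
    (stoneCounitOp σ)

end

/-! ### Description of the functors and the final statement. -/

/-- The tautological identification of the spectrum with the quotient of the space of maximal
filters. -/
def DRA.spectrumIso (A : DRA.{u}) : SpectrumIso A A.spectrum where
  homeo := Homeomorph.refl (MaxFilter A)
  fibres _ _ := MaxFilter.toQuotient_eq_iff

/-- The tautological identification of the algebra of sections. -/
def HausEt.sectionsIso (P : HausEt.{u}) : SectionsIso P P.sections where
  equiv := Equiv.refl (CompactOpenSections P)
  map_diff _ _ := rfl
  map_rest _ _ := rfl

theorem corollary5 (σ : OpSignature.{v}) :
    ∃ (e₀ : CfinDRA.{u} ≌ StoneEt.{u}ᵒᵖ) (e : CfinDRAOp.{u} σ ≌ (StoneEtOp.{u} σ)ᵒᵖ),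
      (IsSpectrumFunctor e₀.functor ∧ IsSectionsFunctor e₀.inverse) ∧
      (IsSpectrumFunctorOp e.functor ∧ IsSectionsFunctorOp e.inverse) ∧
      Nonempty (e.functor ⋙ (StoneEtOp.forget σ).op ≅ CfinDRAOp.forget σ ⋙ e₀.functor) ∧
      Nonempty (e.inverse ⋙ CfinDRAOp.forget σ ≅ (StoneEtOp.forget σ).op ⋙ e₀.inverse) := by
  -- The functors with operators are built over the plain ones, so both forgetful squares commute on
  -- the nose.
  refine ⟨stoneDuality, stoneDualityOp σ, ⟨?_, ?_⟩, ⟨?_, ?_⟩, ⟨Iso.refl _⟩, ⟨Iso.refl _⟩⟩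
  · exact ⟨fun A => A.obj.spectrumIso, fun A B h _ _ => DRA.Hom.mem_comap h.hom⟩
  · exact ⟨fun P => P.unop.obj.sectionsIso, fun _ _ _ _ => rfl⟩
  · exact ⟨fun A => A.obj.alg.spectrumIso, fun A B h _ _ => DRA.Hom.mem_comap h.hom.base,
      fun _ _ _ _ => Iff.rfl⟩
  · exact ⟨fun P => P.unop.obj.space.sectionsIso, fun _ _ _ _ => rfl, fun _ _ _ => rfl⟩
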